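/- Let $G$ be a finite biconnected graph. A rectilinear drawing of $G$ is a planar drawing in which the vertices are distinct points and every edge is a horizontal or vertical segment. A rectilinear representation $H$ of $G$ is a class of rectilinear drawings of $G$ that have the same planar embedding and the same geometric angles at all vertices; its orientation (up to rotation by multiples of $90^\circ$) is fixed, so that for every edge $uv$ it is determined whether $u$ is to the left of, to the right of, above, or below $v$. $H$ is convex if every internal face is a rectangle and the external face is bounded by an orthoconvex polygon, i.e. every horizontal or vertical line meets the closed region bounded by the external face in the empty set or in one segment. A drawing is greedy if for every ordered pair of vertices $u,v$ there is a path from $u$ to $v$ along which the Euclidean distance to $v$ strictly decreases at every step. $H$ is greedy realizable if some rectilinear drawing of $H$ is greedy. Let $D_x$ be the directed graph obtained from $H$ by orienting the horizontal edges from left to right and contracting each maximal path of vertical edges (possibly a single vertex) into a node; let $D_y$ be obtained by orienting the vertical edges upwards and contracting each maximal path of horizontal edges into a node. An $st$-ordering of such a digraph $D$ is a linear order $v_1,\dots,v_m$ of its nodes such that $i<j$ for every arc $(v_i,v_j)$. For $1\le i<j\le m$ let $D\langle i,j\rangle$ be the subgraph of $D$ induced by $v_i,\dots,v_j$. An $st$-ordering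 is good if for all $1\le i<j\le m$: (1) $D\langle i,j\rangle$ has at most two connected components (ignoring directions); and (2) if it has exactly two components, then all nodes of one component precede all nodes of the other in the ordering. Theorem. Let $H$ be a convex rectilinear representation of a biconnected plane graph. Then $H$ is greedy realizable if and only if both $D_x$ and $D_y$ admit good $st$-orderings. -/

import Mathlib

/-- The Euclidean plane. -/
abbrev Plane : Type := EuclideanSpace ℝ (Fin 2)

/-! ### Rectilinear drawings -/

/-- A (planar) rectilinear drawing of a graph: the vertices are distinct points of the plane, every
edge is the horizontal or vertical segment between its two ends, an edge passes through no vertex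
other than its ends, and two distinct edges meet only in a common end. -/
structure RectilinearDrawing {V : Type*} (G : SimpleGraph V) where
  /-- The position of a vertex. -/
  pos : V → Plane
  injective : Function.Injective pos
  axis_parallel : ∀ u v, G.Adj u v → pos u 0 = pos v 0 ∨ pos u 1 = pos v 1
  vertex_on_edge : ∀ u v w, G.Adj u v → pos w ∈ segment ℝ (pos u) (pos v) → w = u ∨ w = v
  planar : ∀ u v u' v', G.Adj u v → G.Adj u' v' → s(u, v) ≠ s(u', v') →
    ∀ p ∈ segment ℝ (pos u) (pos v) ∩ segment ℝ (pos u') (pos v'),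
      ∃ w, w ∈ s(u, v) ∧ w ∈ s(u', v') ∧ p = pos w

namespace RectilinearDrawing

variable {V : Type*} {G : SimpleGraph V}

/-- `u v` is a horizontal edge, and `u` lies to the left of `v` in the drawing. -/
def LeftOf (Γ : RectilinearDrawing G) (u v : V) : Prop :=
  G.Adj u v ∧ Γ.pos u 0 < Γ.pos v 0

/-- `u v` is a vertical edge, and `u` lies below `v` in the drawing. -/
def Below (Γ : RectilinearDrawing G) (u v : V) : Prop :=
  G.Adj u v ∧ Γ.pos u 1 < Γ.pos v 1

/-- The set of points of the plane that are covered by the drawing. -/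
def support (Γ : RectilinearDrawing G) : Set Plane :=
  Set.range Γ.pos ∪ {p | ∃ u v, G.Adj u v ∧ p ∈ segment ℝ (Γ.pos u) (Γ.pos v)}

/-- The face of the drawing that contains a given point off the drawing (as an open region). -/
def face (Γ : RectilinearDrawing G) (p : Plane) : Set Plane :=
  connectedComponentIn Γ.supportᶜ p

/-- The closed region enclosed by the boundary of the external face: the complement of the
external (that is, unbounded) face. -/
def outerPolygon (Γ : RectilinearDrawing G) : Set Plane :=
  {p | p ∈ Γ.support ∨ Bornology.IsBounded (Γ.face p)}

/-- Every internal face is a rectangle. -/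
def InternalFacesRectangular (Γ : RectilinearDrawing G) : Prop :=
  ∀ p ∉ Γ.support, Bornology.IsBounded (Γ.face p) →
    ∃ a b c d : ℝ, Γ.face p = {q | q 0 ∈ Set.Ioo a b ∧ q 1 ∈ Set.Ioo c d}

/-- The region bounded by the external face is orthoconvex: every horizontal or vertical line meets
it in the empty set or in one segment. -/
def OuterFaceOrthoconvex (Γ : RectilinearDrawing G) : Prop :=
  (∀ y : ℝ, Set.OrdConnected {x : ℝ | !₂[x, y] ∈ Γ.outerPolygon}) ∧
    ∀ x : ℝ, Set.OrdConnected {y : ℝ | !₂[x, y] ∈ Γ.outerPolygon}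

/-- A path (given as a walk) is distance-decreasing in the drawing if every step strictly decreases
the Euclidean distance to the last vertex. -/
def DistanceDecreasing (Γ : RectilinearDrawing G) {u v : V} (p : G.Walk u v) : Prop :=
  ∀ i < p.length,
    dist (Γ.pos (p.getVert (i + 1))) (Γ.pos v) < dist (Γ.pos (p.getVert i)) (Γ.pos v)

/-- The drawing is greedy: any ordered pair of vertices is joined by a distance-decreasing path. -/
def IsGreedy (Γ : RectilinearDrawing G) : Prop :=
  ∀ u v : V, ∃ p : G.Walk u v, p.IsPath ∧ Γ.DistanceDecreasing p

end RectilinearDrawing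

/-! ### Rectilinear representations -/

/-- A rectilinear representation of `G`: a class of planar rectilinear drawings of `G` with the same
shape. It is recorded by the direction of every edge: `leftOf u v` says that `u v` is a
horizontal edge with `u` on the left, `below u v` that it is a vertical edge with `u` below; these
are the directions in some planar rectilinear drawing. For a connected graph, the directions of
the edges, up to a common rotation by a multiple of 90 degrees, carry the same information as the
planar embedding together with the geometric angles at the vertices. As usual, the rotation is
fixed once and for all. -/
structure RectilinearRepresentation {V : Type*} (G : SimpleGraph V) where
  /-- `u v` is a horizontal edge with left end `u`. -/
  leftOf : V → V → Prop
  /-- `u v` is a vertical edge with lower end `u`. -/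
  below : V → V → Prop
  realized : ∃ Γ : RectilinearDrawing G,
    (∀ u v, Γ.LeftOf u v ↔ leftOf u v) ∧ ∀ u v, Γ.Below u v ↔ below u v

/-- The digraph whose nodes are the connected components (maximal paths, for the relations below) of
the edges given by `s`, each contracted to one node, and whose arcs are given by `r`. -/
def contractedDigraph {V : Type*} (r s : V → V → Prop) :
    Digraph (SimpleGraph.fromRel s).ConnectedComponent where
  Adj C C' := ∃ u v, r u v ∧ (SimpleGraph.fromRel s).connectedComponentMk u = C ∧
    (SimpleGraph.fromRel s).connectedComponentMk v = C'

namespace RectilinearRepresentation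

variable {V : Type*} {G : SimpleGraph V}

/-- `Γ` is a rectilinear drawing of the representation `H`. -/
def IsDrawing (H : RectilinearRepresentation G) (Γ : RectilinearDrawing G) : Prop :=
  (∀ u v, Γ.LeftOf u v ↔ H.leftOf u v) ∧ ∀ u v, Γ.Below u v ↔ H.below u v

/-- `H` is convex: (in its drawings) all internal faces are rectangles and the external face is
orthoconvex. -/
def IsConvex (H : RectilinearRepresentation G) : Prop :=
  ∀ Γ : RectilinearDrawing G, H.IsDrawing Γ →
    Γ.InternalFacesRectangular ∧ Γ.OuterFaceOrthoconvex

/-- `H` admits a greedy rectilinear drawing. -/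
def GreedyRealizable (H : RectilinearRepresentation G) : Prop :=
  ∃ Γ : RectilinearDrawing G, H.IsDrawing Γ ∧ Γ.IsGreedy

/-- The digraph `D_x`: horizontal edges are oriented from left to right, and each maximal path of
vertical edges (possibly a single vertex) is contracted into a node. -/
abbrev Dx (H : RectilinearRepresentation G) :
    Digraph (SimpleGraph.fromRel H.below).ConnectedComponent :=
  contractedDigraph H.leftOf H.below

/-- The digraph `D_y`: vertical edges are oriented upwards, and each maximal path of horizontal edges
(possibly a single vertex) is contracted into a node. -/
abbrev Dy (H : RectilinearRepresentation G) :
    Digraph (SimpleGraph.fromRel H.leftOf).ConnectedComponent :=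
  contractedDigraph H.below H.leftOf

end RectilinearRepresentation

/-! ### Good st-orderings -/

namespace Digraph

variable {N : Type*}

/-- The linear order `σ 0, σ 1, …, σ (m - 1)` of the nodes of `D` is an st-ordering: every arc goes
from an earlier to a later node. -/
def IsSTOrdering (D : Digraph N) {m : ℕ} (σ : Fin m ≃ N) : Prop :=
  ∀ i j, D.Adj (σ i) (σ j) → i < j

/-- The underlying undirected graph of the subgraph of `D` induced by the nodes `σ i, …, σ j`. -/
abbrev intervalSubgraph (D : Digraph N) {m : ℕ} (σ : Fin m ≃ N) (i j : Fin m) :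
    SimpleGraph (σ '' Set.Icc i j) :=
  D.toSimpleGraphInclusive.induce (σ '' Set.Icc i j)

/-- For all `i < j`, the subgraph induced by the nodes `σ i, …, σ j` has at most two connected
components and, if it has exactly two, then all nodes of one precede all nodes of the other. -/
def IsGoodOrdering (D : Digraph N) {m : ℕ} (σ : Fin m ≃ N) : Prop :=
  ∀ i j, i < j →
    Nat.card (D.intervalSubgraph σ i j).ConnectedComponent ≤ 2 ∧
    (Nat.card (D.intervalSubgraph σ i j).ConnectedComponent = 2 →
      ∃ A B : (D.intervalSubgraph σ i j).ConnectedComponent, A ≠ B ∧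
        ∀ a ∈ A.supp, ∀ b ∈ B.supp, σ.symm a < σ.symm b)

/-- `D` admits a good st-ordering. -/
def AdmitsGoodSTOrdering (D : Digraph N) : Prop :=
  ∃ (m : ℕ) (σ : Fin m ≃ N), D.IsSTOrdering σ ∧ D.IsGoodOrdering σ

end Digraph

/-- A graph is biconnected if it is connected and has no cutvertex. -/
def SimpleGraph.IsBiconnected {V : Type*} (G : SimpleGraph V) : Prop :=
  G.Connected ∧ ∀ v : V, (G.induce {v}ᶜ).Preconnected

/-!
A drawing is greedy if and only if every vertex `p` has, for every other vertex `q`, a neighbour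
closer to `q` (`RectilinearDrawing.isGreedy_iff`); since edges are axis-parallel, a neighbour `w` on
the side of `q` is closer if and only if `q` lies beyond the midpoint of `p` and `w`. Goodness of an
ordering says that in every interval `D⟨i, j⟩` each node is connected to the first or to the last
one (`Digraph.isGoodOrdering_iff`).

The geometry of a convex drawing enters through three facts about its coordinates `ConvexFrame`.
Two nodes of `D_x` that meet a common horizontal line are joined by a directed path, which follows the
sides of the rectangular faces between them (`ConvexFrame.reach_of_onNode`). By orthoconvexity and
connectedness, a vertex without edges to the right and above is alone in its upper right quadrant
(`ConvexFrame.eq_of_corner`), and the box spanned by an edge to the right and an edge upwards at a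
common vertex contains no further vertex (`ConvexFrame.not_mem_corner_box`).

In a greedy drawing, order the nodes by their coordinate. If `q` were separated from both ends of an
interval, let `a < q < c` be the nearest nodes separated from `q`. Incomparable nodes are separated by
a line, so a greedy step from the end of `a` that faces `q` must use an arc, which leads to `c` or
further; thus `q` lies beyond the midpoint of `a` and `c`, and by the same argument from `c` before
it, a contradiction (`ConvexFrame.admitsGoodSTOrdering`).

Conversely, a good ordering provides coordinates with strongly varying gaps between consecutive
nodes: each gap exceeds the sum of all gaps that it dominates (`Dominates`), and goodness makes this
requirement free of cycles (`exists_undominated`, `exists_coordinates`). Any coordinates that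
respect all arcs give a planar drawing of the same representation, because two disjoint edges are
separated by a directed path in `D_x` or in `D_y` (`ConvexFrame.lt_or_lt_of_above_left`,
`ConvexFrame.toDrawing`). For greediness, only a vertex `p` with, say, an edge `p w` to the right
but none upwards matters. The edge cuts the strip between `p` and `w`, so a vertex `q` in the upper
half of the strip is separated from `p` there (`ConvexFrame.eq_of_connIn`), and the choice of the
gaps puts `q` beyond the midpoint of the edge.
-/

/-! ### Good orderings -/

/-- `ConnIn E I a b`: the positions `a` and `b` are joined by a chain of `E`-steps inside `I`. -/
def ConnIn {α : Type*} (E : α → α → Prop) (I : Set α) : α → α → Prop :=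
  Relation.ReflTransGen fun u v => u ∈ I ∧ v ∈ I ∧ E u v

namespace ConnIn

variable {α : Type*} {E : α → α → Prop} {I J : Set α} {a b c : α}

lemma mono (hIJ : I ⊆ J) (h : ConnIn E I a b) : ConnIn E J a b :=
  Relation.ReflTransGen.mono (fun _ _ h => ⟨hIJ h.1, hIJ h.2.1, h.2.2⟩) _ _ h

lemma symm (hE : ∀ u v, E u v → E v u) (h : ConnIn E I a b) : ConnIn E I b a := by
  induction h with
  | refl => exact .refl
  | tail _ h ih => exact .head ⟨h.2.1, h.1, hE _ _ h.2.2⟩ ih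

lemma trans (h : ConnIn E I a b) (h' : ConnIn E I b c) : ConnIn E I a c :=
  Relation.ReflTransGen.trans h h'

/-- A set of positions that no step inside `I` leaves is closed under `ConnIn`. -/
lemma closed {p : α → Prop} (h : ConnIn E I a b) (ha : p a)
    (hp : ∀ u ∈ I, ∀ v ∈ I, p u → E u v → p v) : p b := by
  induction h with
  | refl => exact ha
  | tail _ h ih => exact hp _ h.1 _ h.2.1 ih h.2.2

end ConnIn

namespace Digraph

variable {N : Type*} {m : ℕ}

/-- Adjacency, ignoring directions, between positions of an ordering of the nodes. -/
def PosAdj (D : Digraph N) (σ : Fin m ≃ N) (a b : ℕ) : Prop :=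
  ∃ (ha : a < m) (hb : b < m), D.Adj (σ ⟨a, ha⟩) (σ ⟨b, hb⟩) ∨ D.Adj (σ ⟨b, hb⟩) (σ ⟨a, ha⟩)

lemma PosAdj.symm {D : Digraph N} {σ : Fin m ≃ N} (a b : ℕ) (h : D.PosAdj σ a b) :
    D.PosAdj σ b a := by
  obtain ⟨ha, hb, h⟩ := h
  exact ⟨hb, ha, h.symm⟩

lemma posAdj_of_adj {D : Digraph N} (σ : Fin m ≃ N) {C C' : N} (h : D.Adj C C') :
    D.PosAdj σ (σ.symm C) (σ.symm C') :=
  ⟨Fin.is_lt _, Fin.is_lt _, Or.inl (by simpa using h)⟩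

lemma intervalSubgraph_reachable_iff (D : Digraph N) (σ : Fin m ≃ N) {i j a b : Fin m}
    (ha : a ∈ Set.Icc i j) (hb : b ∈ Set.Icc i j) :
    (D.intervalSubgraph σ i j).Reachable ⟨σ a, Set.mem_image_of_mem _ ha⟩
      ⟨σ b, Set.mem_image_of_mem _ hb⟩ ↔ ConnIn (D.PosAdj σ) (Set.Icc (i : ℕ) j) a b := by
  rw [SimpleGraph.reachable_iff_reflTransGen]
  constructor
  · intro h
    have h' := Relation.ReflTransGen.lift
      (p := fun u v => u ∈ Set.Icc (i : ℕ) j ∧ v ∈ Set.Icc (i : ℕ) j ∧ D.PosAdj σ u v)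
      (fun z : (σ '' Set.Icc i j : Set N) => ((σ.symm z.1 : Fin m) : ℕ)) ?_ _ _ h
    · simpa [Function.onFun, ConnIn] using h'
    · rintro ⟨c, hc⟩ ⟨c', hc'⟩ h
      have mem : ∀ c ∈ σ '' Set.Icc i j, σ.symm c ∈ Set.Icc i j := by
        rintro _ ⟨k, hk, rfl⟩
        simpa using hk
      refine ⟨mem c hc, mem c' hc', Fin.is_lt _, Fin.is_lt _, ?_⟩
      simpa using h.2
  · intro h
    have key : ∀ c : ℕ, ConnIn (D.PosAdj σ) (Set.Icc (i : ℕ) j) a c →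
        ∃ (hc : c < m) (hc' : (⟨c, hc⟩ : Fin m) ∈ Set.Icc i j),
          Relation.ReflTransGen (D.intervalSubgraph σ i j).Adj
            ⟨σ a, Set.mem_image_of_mem _ ha⟩ ⟨σ ⟨c, hc⟩, Set.mem_image_of_mem _ hc'⟩ := by
      intro c hc
      induction hc with
      | refl => exact ⟨a.2, ha, .refl⟩
      | @tail u v _ h ih =>
        obtain ⟨hu, hu', ih⟩ := ih
        obtain ⟨-, hv', _, hv, hadj⟩ := h
        refine ⟨hv, hv', ?_⟩
        by_cases huv : u = v
        · subst huv; exact ih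
        refine ih.tail ?_
        simp only [intervalSubgraph, SimpleGraph.induce, SimpleGraph.comap_adj,
          Function.Embedding.subtype_apply, Digraph.toSimpleGraphInclusive,
          SimpleGraph.fromRel_adj]
        refine ⟨fun h => huv ?_, hadj⟩
        simpa using σ.injective h
    obtain ⟨hc, hc', h⟩ := key b h
    exact h

/-- An ordering is good if and only if, in every interval of positions, every position is connected
to the first or to the last one. -/
lemma isGoodOrdering_iff (D : Digraph N) (σ : Fin m ≃ N) :
    D.IsGoodOrdering σ ↔ ∀ i q j : ℕ, i < q → q < j → j < m →
      ConnIn (D.PosAdj σ) (Set.Icc i j) q i ∨ ConnIn (D.PosAdj σ) (Set.Icc i j) q j := by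
  constructor
  · intro h i q j hiq hqj hj
    let i' : Fin m := ⟨i, by omega⟩
    let q' : Fin m := ⟨q, by omega⟩
    let j' : Fin m := ⟨j, hj⟩
    have hi : i' ∈ Set.Icc i' j' := ⟨le_rfl, by simp only [i', j', Fin.mk_le_mk]; omega⟩
    have hjj : j' ∈ Set.Icc i' j' := ⟨by simp only [i', j', Fin.mk_le_mk]; omega, le_rfl⟩
    have hq : q' ∈ Set.Icc i' j' :=
      ⟨by simp only [i', q', Fin.mk_le_mk]; omega, by simp only [q', j', Fin.mk_le_mk]; omega⟩
    obtain ⟨h2, h3⟩ := h i' j' (by simp only [i', j', Fin.mk_lt_mk]; omega)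
    by_contra! hcon
    have e1 := (D.intervalSubgraph_reachable_iff σ hq hi).not.2 hcon.1
    have e2 := (D.intervalSubgraph_reachable_iff σ hq hjj).not.2 hcon.2
    set K := D.intervalSubgraph σ i' j'
    rw [← SimpleGraph.ConnectedComponent.eq] at e1 e2
    have : Finite (σ '' Set.Icc i' j' : Set N) := (Set.toFinite _).image _
    have hcard : Nat.card K.ConnectedComponent = 2 := by
      refine le_antisymm h2 ?_
      have : Nontrivial K.ConnectedComponent := ⟨_, _, e1⟩
      exact Finite.one_lt_card
    obtain ⟨A, B, hAB, hprec⟩ := h3 hcard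
    obtain ⟨A', B', hAB', huniv⟩ := Nat.card_eq_two_iff.1 hcard
    have all : ∀ c : K.ConnectedComponent, c = A' ∨ c = B' := fun c => by
      have : c ∈ ({A', B'} : Set K.ConnectedComponent) := huniv ▸ Set.mem_univ c
      simpa using this
    have hA := all A
    have hB := all B
    generalize hci : K.connectedComponentMk ⟨σ i', Set.mem_image_of_mem _ hi⟩ = ci at *
    generalize hcq : K.connectedComponentMk ⟨σ q', Set.mem_image_of_mem _ hq⟩ = cq at *
    generalize hcj : K.connectedComponentMk ⟨σ j', Set.mem_image_of_mem _ hjj⟩ = cj at *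
    have hq2 := all cq
    have hi2 := all ci
    have hj2 := all cj
    have hij : ci = cj := by grind
    have hor : (ci = A ∧ cq = B) ∨ (cq = A ∧ ci = B) := by grind
    rcases hor with ⟨hA, hB⟩ | ⟨hA, hB⟩
    · have := hprec _ ((hcj.trans hij.symm).trans hA) _ (hcq.trans hB)
      simp only [Equiv.symm_apply_apply, q', j', Fin.mk_lt_mk] at this
      omega
    · have := hprec _ (hcq.trans hA) _ (hci.trans hB)
      simp only [Equiv.symm_apply_apply, q', i', Fin.mk_lt_mk] at this
      omega
  · intro h i j hij
    have hi : i ∈ Set.Icc i j := ⟨le_rfl, hij.le⟩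
    have hj : j ∈ Set.Icc i j := ⟨hij.le, le_rfl⟩
    set K := D.intervalSubgraph σ i j
    have : Finite (σ '' Set.Icc i j : Set N) := (Set.toFinite _).image _
    set ci := K.connectedComponentMk ⟨σ i, Set.mem_image_of_mem _ hi⟩ with hci
    set cj := K.connectedComponentMk ⟨σ j, Set.mem_image_of_mem _ hj⟩ with hcj
    have hall : ∀ q (hq : q ∈ Set.Icc i j),
        K.connectedComponentMk ⟨σ q, Set.mem_image_of_mem _ hq⟩ = ci ∨
        K.connectedComponentMk ⟨σ q, Set.mem_image_of_mem _ hq⟩ = cj := by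
      intro q hq
      rcases eq_or_lt_of_le hq.1 with rfl | h1
      · exact Or.inl rfl
      rcases eq_or_lt_of_le hq.2 with rfl | h2
      · exact Or.inr rfl
      simp only [hci, hcj, SimpleGraph.ConnectedComponent.eq, K]
      rw [D.intervalSubgraph_reachable_iff σ hq hi, D.intervalSubgraph_reachable_iff σ hq hj]
      exact h i q j h1 h2 j.2
    have hall' : ∀ c : K.ConnectedComponent, c = ci ∨ c = cj := by
      intro c
      induction c using SimpleGraph.ConnectedComponent.ind with
      | h v => obtain ⟨_, q, hq, rfl⟩ := v; exact hall q hq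
    have huniv : (Set.univ : Set K.ConnectedComponent) = {ci, cj} := by
      ext c; simpa using hall' c
    refine ⟨?_, fun h2 => ?_⟩
    · rw [← Set.ncard_univ, huniv]
      exact Set.ncard_insert_le _ _ |>.trans (by simp)
    · have hne : ci ≠ cj := by
        intro he
        rw [← Set.ncard_univ, huniv, he] at h2
        simp at h2
      refine ⟨ci, cj, hne, ?_⟩
      rintro ⟨_, a, ha, rfl⟩ ha2 ⟨_, b, hb, rfl⟩ hb2
      simp only [Equiv.symm_apply_apply]
      rw [SimpleGraph.ConnectedComponent.mem_supp_iff] at ha2 hb2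
      by_contra hba
      have hab : a ≠ b := by
        rintro rfl; exact hne (ha2.symm.trans hb2)
      have hlt : b < a := lt_of_le_of_ne (not_lt.1 hba) hab.symm
      rcases eq_or_lt_of_le hb.1 with rfl | hib
      · exact hne hb2
      have sub : Set.Icc (i : ℕ) a ⊆ Set.Icc (i : ℕ) j :=
        Set.Icc_subset_Icc_right (Fin.le_def.1 ha.2)
      rcases h i b a hib hlt a.2 with h1 | h1
      · have := (D.intervalSubgraph_reachable_iff σ hb hi).2 (h1.mono sub)
        rw [← SimpleGraph.ConnectedComponent.eq] at this
        exact hne (this.symm.trans hb2)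
      · have := (D.intervalSubgraph_reachable_iff σ hb ha).2 (h1.mono sub)
        rw [← SimpleGraph.ConnectedComponent.eq] at this
        exact hne (ha2.symm.trans (this.symm.trans hb2))

lemma connIn_of_transGen {N : Type*} {D : Digraph N} {m : ℕ} {σ : Fin m ≃ N}
    (hσ : D.IsSTOrdering σ) {C C' : N} (h : Relation.TransGen D.Adj C C') :
    σ.symm C < σ.symm C' ∧
      ConnIn (D.PosAdj σ) (Set.Icc (σ.symm C : ℕ) (σ.symm C')) (σ.symm C) (σ.symm C') := by
  have lt : ∀ {C C' : N}, D.Adj C C' → σ.symm C < σ.symm C' := fun h => hσ _ _ (by simpa using h)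
  induction h with
  | single h =>
    have h1 := Fin.lt_def.1 (lt h)
    exact ⟨lt h, .single ⟨⟨le_rfl, h1.le⟩, ⟨h1.le, le_rfl⟩, posAdj_of_adj σ h⟩⟩
  | tail _ h ih =>
    have h1 := Fin.lt_def.1 (lt h)
    have h2 := Fin.lt_def.1 ih.1
    refine ⟨ih.1.trans (lt h), (ih.2.mono (Set.Icc_subset_Icc_right h1.le)).tail
      ⟨⟨h2.le, h1.le⟩, ⟨(h2.trans h1).le, le_rfl⟩, posAdj_of_adj σ h⟩⟩

end Digraph

lemma exists_sorting {N : Type*} [Finite N] {f : N → ℝ} (hf : Function.Injective f) :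
    ∃ (m : ℕ) (σ : Fin m ≃ N), ∀ i j, i < j ↔ f (σ i) < f (σ j) := by
  let := LinearOrder.lift' f hf
  let := Fintype.ofFinite N
  let σ := Fintype.orderIsoFinOfCardEq N rfl
  exact ⟨_, σ.toEquiv, fun i j => σ.lt_iff_lt.symm⟩

/-! ### Coordinates for a good ordering -/

section Gaps

/-- The gap behind position `k` dominates the gap behind `k'` if the end of the first gap that is
farther from the second one, that is `k` for `k < k'` and `k + 1` for `k' < k`, has no `E`-neighbour
among the positions between the two gaps. Coordinates are chosen so that a gap is longer than all the
gaps it dominates together. -/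
def Dominates (E : ℕ → ℕ → Prop) (k k' : ℕ) : Prop :=
  (k < k' ∧ ∀ v, k < v → v ≤ k' → ¬ E k v) ∨ (k' < k ∧ ∀ v, k' < v → v ≤ k → ¬ E v (k + 1))

variable {E : ℕ → ℕ → Prop} {m : ℕ}

/-- If domination had a two-cycle `k < k'`, the block `k + 1, …, k'` would be separated from both
ends of the interval from `k` to `k' + 1`. -/
lemma not_dominates_symm (hE : ∀ u v, E u v → E v u)
    (hgood : ∀ i q j : ℕ, i < q → q < j → j < m →
      ConnIn E (Set.Icc i j) q i ∨ ConnIn E (Set.Icc i j) q j)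
    {k k' : ℕ} (hlt : k < k') (hk' : k' + 1 < m) (h1 : Dominates E k k') (h2 : Dominates E k' k) :
    False := by
  rcases h1 with ⟨-, h1⟩ | ⟨h, -⟩
  swap
  · omega
  rcases h2 with ⟨h, -⟩ | ⟨-, h2⟩
  · omega
  -- The block `k + 1, …, k'` has no `E`-neighbour at either end of the interval `k, …, k' + 1`.
  have closed : ∀ u ∈ Set.Icc k (k' + 1), ∀ v ∈ Set.Icc k (k' + 1),
      (k < u ∧ u ≤ k') → E u v → (k < v ∧ v ≤ k') := by
    intro u hu v hv hku huv
    simp only [Set.mem_Icc] at hu hv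
    by_contra hcon
    have : v = k ∨ v = k' + 1 := by omega
    rcases this with rfl | rfl
    · exact h1 u hku.1 hku.2 (hE _ _ huv)
    · exact h2 u hku.1 hku.2 huv
  rcases hgood k (k + 1) (k' + 1) (by omega) (by omega) hk' with h | h
  · have := h.closed (p := fun u => k < u ∧ u ≤ k') ⟨by omega, by omega⟩ closed
    omega
  · have := h.closed (p := fun u => k < u ∧ u ≤ k') ⟨by omega, by omega⟩ closed
    omega

/-- Since the positions dominated by `k` form an interval around `k`, the absence of two-cycles
excludes all cycles: every finite set has an undominated element. -/
lemma exists_undominated (hE : ∀ u v, E u v → E v u)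
    (hgood : ∀ i q j : ℕ, i < q → q < j → j < m →
      ConnIn E (Set.Icc i j) q i ∨ ConnIn E (Set.Icc i j) q j)
    (S : Finset ℕ) (hS : ∀ k ∈ S, k + 1 < m) (hne : S.Nonempty) :
    ∃ k ∈ S, ∀ k' ∈ S, ¬ Dominates E k' k := by
  induction S using Finset.induction_on_min with
  | empty => simp at hne
  | insert a S ha ih =>
    have irrefl : ∀ k, ¬ Dominates E k k := by
      rintro k (⟨h, -⟩ | ⟨h, -⟩) <;> omega
    rcases S.eq_empty_or_nonempty with rfl | hne'
    · exact ⟨a, by simp, by simpa using irrefl a⟩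
    obtain ⟨b, hb, hmax⟩ := ih (fun k hk => hS k (by simp [hk])) hne'
    -- If the least element `a` dominates `b`, a gap dominating `a` would either be dominated by `a`
    -- or lie beyond `b` and dominate `b` as well.
    by_cases hab : Dominates E a b
    · refine ⟨a, by simp, fun k hk hka => ?_⟩
      rcases Finset.mem_insert.1 hk with rfl | hk'
      · exact irrefl _ hka
      have hak := ha k hk'
      by_cases hkb : k ≤ b
      · refine not_dominates_symm hE hgood hak (hS k hk) ?_ hka
        rcases hab with ⟨-, h⟩ | ⟨h, -⟩
        · exact Or.inl ⟨hak, fun v h1 h2 => h v h1 (h2.trans hkb)⟩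
        · have := ha b hb; omega
      · refine hmax k hk' ?_
        have := ha b hb
        rcases hka with ⟨h, -⟩ | ⟨-, h⟩
        · omega
        · exact Or.inr ⟨by omega, fun v h1 h2 => h v (by omega) h2⟩
    · refine ⟨b, by simp [hb], fun k hk => ?_⟩
      rcases Finset.mem_insert.1 hk with rfl | hk'
      · exact hab
      · exact hmax k hk'

open Classical in
/-- Gap lengths are chosen by removing an undominated gap, whose length does not matter to the
others, and adding it back with a sufficiently large length. -/
lemma exists_gaps (hE : ∀ u v, E u v → E v u)
    (hgood : ∀ i q j : ℕ, i < q → q < j → j < m →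
      ConnIn E (Set.Icc i j) q i ∨ ConnIn E (Set.Icc i j) q j)
    (S : Finset ℕ) (hS : ∀ k ∈ S, k + 1 < m) :
    ∃ g : ℕ → ℝ, (∀ k, 0 < g k) ∧ ∀ k ∈ S, ∑ k' ∈ S with Dominates E k k', g k' < g k := by
  induction S using Finset.strongInduction with
  | H S ih =>
    rcases S.eq_empty_or_nonempty with rfl | hne
    · exact ⟨fun _ => 1, by simp, by simp⟩
    obtain ⟨b, hb, hmax⟩ := exists_undominated hE hgood S hS hne
    obtain ⟨g, hpos, hg⟩ := ih (S.erase b) (Finset.erase_ssubset hb)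
      (fun k hk => hS k (Finset.mem_of_mem_erase hk))
    have hsum : ∀ k ∈ S, ∀ t : ℝ, ∑ k' ∈ S with Dominates E k k', Function.update g b t k' =
        ∑ k' ∈ S.erase b with Dominates E k k', g k' := by
      intro k hk t
      have : (S.filter fun k' => Dominates E k k') =
          (S.erase b).filter fun k' => Dominates E k k' := by
        ext k'
        simp only [Finset.mem_filter, Finset.mem_erase]
        refine ⟨fun h => ⟨⟨?_, h.1⟩, h.2⟩, fun h => ⟨h.1.2, h.2⟩⟩
        rintro rfl
        exact hmax k hk h.2
      rw [this]
      refine Finset.sum_congr rfl fun k' hk' => ?_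
      rw [Function.update_of_ne]
      simp only [Finset.mem_filter, Finset.mem_erase] at hk'
      exact hk'.1.1
    have hnn : 0 ≤ ∑ k' ∈ S.erase b with Dominates E b k', g k' :=
      Finset.sum_nonneg fun k _ => (hpos k).le
    refine ⟨Function.update g b (∑ k' ∈ S.erase b with Dominates E b k', g k' + 1), ?_, ?_⟩
    · intro k
      by_cases hk : k = b
      · subst hk; simp only [Function.update_self]; linarith
      · rw [Function.update_of_ne hk]; exact hpos k
    · intro k hk
      rw [hsum k hk]
      by_cases hkb : k = b
      · subst hkb; simp
      · rw [Function.update_of_ne hkb]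
        exact hg k (Finset.mem_erase.2 ⟨hkb, hk⟩)

/-- If the ends of an interval are not connected, a gap `k` separates it into two blocks, the
positions connected to the first and to the last one. -/
lemma exists_split (hE : ∀ u v, E u v → E v u)
    (hgood : ∀ i q j : ℕ, i < q → q < j → j < m →
      ConnIn E (Set.Icc i j) q i ∨ ConnIn E (Set.Icc i j) q j)
    {i j a b : ℕ} (hj : j < m) (hia : i ≤ a) (hab : a < b) (hbj : b ≤ j)
    (h : ¬ ConnIn E (Set.Icc i j) a b) :
    ∃ k, a ≤ k ∧ k < b ∧ ∀ u v, i ≤ u → u ≤ k → k < v → v ≤ j → ¬ E u v := by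
  have dich : ∀ q, i ≤ q → q ≤ j →
      ConnIn E (Set.Icc i j) q i ∨ ConnIn E (Set.Icc i j) q j := by
    intro q h1 h2
    rcases eq_or_lt_of_le h1 with rfl | h1
    · exact Or.inl .refl
    rcases eq_or_lt_of_le h2 with rfl | h2
    · exact Or.inr .refl
    exact hgood i q j h1 h2 hj
  have hij : ¬ ConnIn E (Set.Icc i j) i j := by
    intro hc
    have all : ∀ q, i ≤ q → q ≤ j → ConnIn E (Set.Icc i j) q i := fun q h1 h2 =>
      (dich q h1 h2).elim id fun h => h.trans (hc.symm hE)
    exact h ((all a hia (by omega)).trans ((all b (by omega) hbj).symm hE))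
  have init : ∀ q q', i ≤ q → q ≤ q' → q' ≤ j → ConnIn E (Set.Icc i j) q' i →
      ConnIn E (Set.Icc i j) q i := by
    intro q q' h1 h2 h3 hc
    rcases eq_or_lt_of_le h1 with rfl | h1
    · exact .refl
    rcases eq_or_lt_of_le h2 with rfl | h2
    · exact hc
    have sub : Set.Icc i q' ⊆ Set.Icc i j := Set.Icc_subset_Icc_right h3
    rcases hgood i q q' h1 h2 (by omega) with h | h
    · exact h.mono sub
    · exact (h.mono sub).trans hc
  classical
  have hai : ConnIn E (Set.Icc i j) a i := by
    rcases dich a hia (by omega) with h1 | h1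
    · exact h1
    rcases dich b (by omega) hbj with h2 | h2
    · exact init a b hia hab.le hbj h2
    · exact absurd (h1.trans (h2.symm hE)) h
  have hbi : ¬ ConnIn E (Set.Icc i j) b i := fun hc => h (hai.trans (hc.symm hE))
  refine ⟨Nat.findGreatest (fun q => q ≤ j ∧ ConnIn E (Set.Icc i j) q i) j, ?_, ?_, ?_⟩
  · exact Nat.le_findGreatest (by omega) ⟨by omega, hai⟩
  · have hs := Nat.findGreatest_spec (P := fun q => q ≤ j ∧ ConnIn E (Set.Icc i j) q i)
      (m := a) (n := j) (by omega) ⟨by omega, hai⟩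
    by_contra hle
    exact hbi (init b _ (by omega) (not_lt.1 hle) hs.1 hs.2)
  · intro u v h1 h2 h3 h4 huv
    have hs := Nat.findGreatest_spec (P := fun q => q ≤ j ∧ ConnIn E (Set.Icc i j) q i)
      (m := a) (n := j) (by omega) ⟨by omega, hai⟩
    have hu := init u _ h1 h2 hs.1 hs.2
    refine Nat.findGreatest_is_greatest h3 h4 ⟨h4, ?_⟩
    exact .head ⟨⟨by omega, h4⟩, ⟨h1, by omega⟩, hE _ _ huv⟩ hu

/-- Coordinates for the positions of a good ordering: whenever two positions `i < j` are separated
up to a further position `l` (or down to a position `h`), the distance between them exceeds the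
distance from `j` to `l` (from `h` to `i`). -/
lemma exists_coordinates (hE : ∀ u v, E u v → E v u)
    (hgood : ∀ i q j : ℕ, i < q → q < j → j < m →
      ConnIn E (Set.Icc i j) q i ∨ ConnIn E (Set.Icc i j) q j) :
    ∃ X : ℕ → ℝ, StrictMono X ∧
      (∀ i j l, i < j → j < l → l < m → ¬ ConnIn E (Set.Ico i l) i j → X l - X j < X j - X i) ∧
      (∀ h i j, h < i → i < j → j < m → ¬ ConnIn E (Set.Ioc h j) i j →
        X i - X h < X j - X i) := by
  classical
  obtain ⟨g, hpos, hg⟩ := exists_gaps hE hgood (Finset.range (m - 1))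
    (fun k hk => by have := Finset.mem_range.1 hk; omega)
  have hdiff : ∀ a b, a ≤ b → ∑ k ∈ Finset.range b, g k - ∑ k ∈ Finset.range a, g k =
      ∑ k ∈ Finset.Ico a b, g k := fun a b hab => (Finset.sum_Ico_eq_sub g hab).symm
  have hone : ∀ k a b, a ≤ k → k < b → g k ≤ ∑ k ∈ Finset.Ico a b, g k := fun k a b h1 h2 =>
    Finset.single_le_sum (fun k _ => (hpos k).le) (Finset.mem_Ico.2 ⟨h1, h2⟩)
  have hdom : ∀ k a b, k + 1 < m → b < m → (∀ k', a ≤ k' → k' < b → Dominates E k k') →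
      ∑ k ∈ Finset.Ico a b, g k < g k := by
    intro k a b hk hb h
    refine lt_of_le_of_lt ?_ (hg k (Finset.mem_range.2 (by omega)))
    refine Finset.sum_le_sum_of_subset_of_nonneg ?_ fun k _ _ => (hpos k).le
    intro k' hk'
    rw [Finset.mem_Ico] at hk'
    simp only [Finset.mem_filter, Finset.mem_range]
    exact ⟨by omega, h k' hk'.1 hk'.2⟩
  refine ⟨fun n => ∑ k ∈ Finset.range n, g k, ?_, ?_, ?_⟩
  · refine strictMono_nat_of_lt_succ fun n => ?_
    rw [Finset.sum_range_succ]
    linarith [hpos n]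
  · intro i j l hij hjl hl h
    have hI : Set.Ico i l = Set.Icc i (l - 1) := by
      ext; simp only [Set.mem_Ico, Set.mem_Icc]; omega
    rw [hI] at h
    obtain ⟨k, h1, h2, h3⟩ := exists_split hE hgood (by omega) le_rfl hij (by omega) h
    rw [hdiff j l hjl.le, hdiff i j hij.le]
    refine lt_of_lt_of_le (hdom k j l (by omega) hl fun k' h4 h5 => Or.inl ⟨by omega, ?_⟩)
      (hone k i j h1 h2)
    exact fun v h6 h7 => h3 k v h1 le_rfl h6 (by omega)
  · intro h i j hhi hij hj hc
    have hI : Set.Ioc h j = Set.Icc (h + 1) j := by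
      ext; simp only [Set.mem_Ioc, Set.mem_Icc]; omega
    rw [hI] at hc
    obtain ⟨k, h1, h2, h3⟩ := exists_split hE hgood hj (by omega) hij le_rfl hc
    rw [hdiff h i hhi.le, hdiff i j hij.le]
    refine lt_of_lt_of_le (hdom k h i (by omega) (by omega) fun k' h4 h5 => Or.inr ⟨by omega, ?_⟩)
      (hone k i j h1 h2)
    exact fun v h6 h7 => h3 v (k + 1) (by omega) h7 (by omega) (by omega)

end Gaps

/-! ### Convex drawings in coordinates -/

section Frame

variable {V : Type*}

/-- The point `(a, b)` lies in the axis-parallel box spanned by the positions of `u` and `v`; if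
these are joined by a horizontal or vertical segment, the box is that segment. -/
def InBox (x y : V → ℝ) (u v : V) (a b : ℝ) : Prop :=
  a ∈ Set.uIcc (x u) (x v) ∧ b ∈ Set.uIcc (y u) (y v)

/-- The point `(a, b)` lies on a vertex or an edge. -/
def Covered (G : SimpleGraph V) (x y : V → ℝ) (a b : ℝ) : Prop :=
  ∃ u v, (u = v ∨ G.Adj u v) ∧ InBox x y u v a b

/-- A convex rectilinear drawing, in coordinates: vertex `v` has position `(x v, y v)`, the relation
`r` holds for the horizontal edges from left to right, `s` for the vertical edges upwards, and `P`
is the region bounded by the external face. The field `face` is all that is used about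
internal faces: a point of the region off the drawing lies in an open rectangle that the drawing
avoids and whose boundary it covers. The axioms are invariant under the symmetries of the square. -/
structure ConvexFrame (G : SimpleGraph V) (x y : V → ℝ) (r s : V → V → Prop)
    (P : ℝ → ℝ → Prop) : Prop where
  conn : G.Connected
  axis : ∀ u v, G.Adj u v → x u = x v ∨ y u = y v
  inj : ∀ u v, x u = x v → y u = y v → u = v
  r_iff : ∀ u v, r u v ↔ G.Adj u v ∧ x u < x v
  s_iff : ∀ u v, s u v ↔ G.Adj u v ∧ y u < y v
  meet : ∀ u v u' v', (u = v ∨ G.Adj u v) → (u' = v' ∨ G.Adj u' v') → ∀ a b,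
    InBox x y u v a b → InBox x y u' v' a b →
    s(u, v) = s(u', v') ∨ ∃ w, (w = u ∨ w = v) ∧ (w = u' ∨ w = v') ∧ x w = a ∧ y w = b
  sub : ∀ a b, Covered G x y a b → P a b
  conv_h : ∀ a a' a'' b, P a b → P a'' b → a ≤ a' → a' ≤ a'' → P a' b
  conv_v : ∀ a b b' b'', P a b → P a b'' → b ≤ b' → b' ≤ b'' → P a b'
  face : ∀ a b, P a b → ¬ Covered G x y a b → ∃ a₁ a₂ b₁ b₂, a₁ < a ∧ a < a₂ ∧ b₁ < b ∧ b < b₂ ∧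
    (∀ a' b', a₁ < a' → a' < a₂ → b₁ < b' → b' < b₂ → ¬ Covered G x y a' b') ∧
    (∀ a', a₁ ≤ a' → a' ≤ a₂ → Covered G x y a' b₁ ∧ Covered G x y a' b₂) ∧
    (∀ b', b₁ ≤ b' → b' ≤ b₂ → Covered G x y a₁ b' ∧ Covered G x y a₂ b')

lemma InBox.swap {x y : V → ℝ} {u v : V} {a b : ℝ} (h : InBox x y u v a b) : InBox y x u v b a :=
  ⟨h.2, h.1⟩

lemma InBox.comm {x y : V → ℝ} {u v : V} {a b : ℝ} (h : InBox x y u v a b) : InBox x y v u a b := by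
  unfold InBox
  rwa [Set.uIcc_comm (x v), Set.uIcc_comm (y v)]

lemma neg_mem_uIcc_neg_iff {a b c : ℝ} : a ∈ Set.uIcc (-b) (-c) ↔ -a ∈ Set.uIcc b c := by
  simp only [Set.mem_uIcc]
  constructor <;> rintro (⟨h1, h2⟩ | ⟨h1, h2⟩)
  · right; constructor <;> linarith
  · left; constructor <;> linarith
  · right; constructor <;> linarith
  · left; constructor <;> linarith

lemma inBox_neg_iff {x y : V → ℝ} {u v : V} {a b : ℝ} :
    InBox (fun w => -x w) y u v a b ↔ InBox x y u v (-a) b := by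
  simp only [InBox, neg_mem_uIcc_neg_iff]

lemma covered_swap_iff {G : SimpleGraph V} {x y : V → ℝ} {a b : ℝ} :
    Covered G y x b a ↔ Covered G x y a b :=
  ⟨fun ⟨u, v, h, h'⟩ => ⟨u, v, h, h'.swap⟩, fun ⟨u, v, h, h'⟩ => ⟨u, v, h, h'.swap⟩⟩

lemma covered_neg_iff {G : SimpleGraph V} {x y : V → ℝ} {a b : ℝ} :
    Covered G (fun w => -x w) y a b ↔ Covered G x y (-a) b := by
  simp only [Covered, inBox_neg_iff]

lemma covered_vertex {G : SimpleGraph V} {x y : V → ℝ} (v : V) : Covered G x y (x v) (y v) :=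
  ⟨v, v, Or.inl rfl, by simp [InBox]⟩

namespace ConvexFrame

variable {G : SimpleGraph V} {x y : V → ℝ} {r s : V → V → Prop} {P : ℝ → ℝ → Prop}

lemma swap (F : ConvexFrame G x y r s P) : ConvexFrame G y x s r (fun a b => P b a) where
  conn := F.conn
  axis u v h := (F.axis u v h).symm
  inj u v h h' := F.inj u v h' h
  r_iff := F.s_iff
  s_iff := F.r_iff
  meet u v u' v' h h' a b h1 h2 := by
    rcases F.meet u v u' v' h h' b a h1.swap h2.swap with h | ⟨w, h1, h2, h3, h4⟩
    · exact Or.inl h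
    · exact Or.inr ⟨w, h1, h2, h4, h3⟩
  sub a b h := F.sub b a (covered_swap_iff.1 h)
  conv_h a a' a'' b := F.conv_v b a a' a''
  conv_v a b b' b'' := F.conv_h b b' b'' a
  face a b h h' := by
    obtain ⟨a₁, a₂, b₁, b₂, h1, h2, h3, h4, h5, h6, h7⟩ := F.face b a h (covered_swap_iff.not.1 h')
    exact ⟨b₁, b₂, a₁, a₂, h3, h4, h1, h2,
      fun a' b' k1 k2 k3 k4 => covered_swap_iff.not.1 (h5 b' a' k3 k4 k1 k2),
      fun a' k1 k2 => ⟨covered_swap_iff.1 (h7 a' k1 k2).1, covered_swap_iff.1 (h7 a' k1 k2).2⟩,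
      fun a' k1 k2 => ⟨covered_swap_iff.1 (h6 a' k1 k2).1, covered_swap_iff.1 (h6 a' k1 k2).2⟩⟩

lemma negx (F : ConvexFrame G x y r s P) :
    ConvexFrame G (fun v => -x v) y (fun u v => r v u) s (fun a b => P (-a) b) where
  conn := F.conn
  axis u v h := (F.axis u v h).imp (fun h => by rw [h]) id
  inj u v h h' := F.inj u v (neg_injective h) h'
  r_iff u v := by rw [F.r_iff, G.adj_comm, neg_lt_neg_iff]
  s_iff := F.s_iff
  meet u v u' v' h h' a b h1 h2 := by
    rcases F.meet u v u' v' h h' (-a) b (inBox_neg_iff.1 h1) (inBox_neg_iff.1 h2) with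
      h | ⟨w, h1, h2, h3, h4⟩
    · exact Or.inl h
    · exact Or.inr ⟨w, h1, h2, by simp [h3], h4⟩
  sub a b h := F.sub (-a) b (covered_neg_iff.1 h)
  conv_h a a' a'' b h h' h1 h2 := F.conv_h _ _ _ b h' h (neg_le_neg h2) (neg_le_neg h1)
  conv_v a b b' b'' := F.conv_v (-a) b b' b''
  face a b h h' := by
    obtain ⟨a₁, a₂, b₁, b₂, h1, h2, h3, h4, h5, h6, h7⟩ :=
      F.face (-a) b h (covered_neg_iff.not.1 h')
    refine ⟨-a₂, -a₁, b₁, b₂, by linarith, by linarith, h3, h4,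
      fun a' b' k1 k2 k3 k4 => covered_neg_iff.not.2
        (h5 _ b' (by linarith) (by linarith) k3 k4),
      fun a' k1 k2 => ?_, fun b' k1 k2 => ?_⟩
    · have := h6 (-a') (by linarith) (by linarith)
      exact ⟨covered_neg_iff.2 this.1, covered_neg_iff.2 this.2⟩
    · have := h7 b' k1 k2
      exact ⟨covered_neg_iff.2 (by simpa using this.2), covered_neg_iff.2 (by simpa using this.1)⟩

lemma negy (F : ConvexFrame G x y r s P) :
    ConvexFrame G x (fun v => -y v) r (fun u v => s v u) (fun a b => P a (-b)) :=
  F.swap.negx.swap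

lemma y_eq_of_r (F : ConvexFrame G x y r s P) {u v : V} (h : r u v) : y u = y v := by
  obtain ⟨h1, h2⟩ := (F.r_iff u v).1 h
  exact (F.axis u v h1).resolve_left h2.ne

lemma x_eq_of_s (F : ConvexFrame G x y r s P) {u v : V} (h : s u v) : x u = x v :=
  F.swap.y_eq_of_r h

lemma r_or_r (F : ConvexFrame G x y r s P) {u v : V} (h : G.Adj u v) (hy : y u = y v) :
    r u v ∨ r v u := by
  rcases lt_trichotomy (x u) (x v) with h1 | h1 | h1
  · exact Or.inl ((F.r_iff u v).2 ⟨h, h1⟩)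
  · exact absurd (F.inj u v h1 hy) h.ne
  · exact Or.inr ((F.r_iff v u).2 ⟨h.symm, h1⟩)

lemma s_or_s (F : ConvexFrame G x y r s P) {u v : V} (h : G.Adj u v) (hx : x u = x v) :
    s u v ∨ s v u :=
  F.swap.r_or_r h hx

lemma adj_cases (F : ConvexFrame G x y r s P) {u v : V} (h : G.Adj u v) :
    (r u v ∨ r v u) ∨ (s u v ∨ s v u) :=
  (F.axis u v h).elim (fun h' => Or.inr (F.s_or_s h h')) fun h' => Or.inl (F.r_or_r h h')

/-! ### Nodes of the contracted digraph -/

/-- The node of the vertical path through `v`. -/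
abbrev node (s : V → V → Prop) (v : V) : (SimpleGraph.fromRel s).ConnectedComponent :=
  (SimpleGraph.fromRel s).connectedComponentMk v

lemma node_eq_of_s (F : ConvexFrame G x y r s P) {u v : V} (h : s u v) : node s u = node s v := by
  refine SimpleGraph.ConnectedComponent.sound (SimpleGraph.Adj.reachable ?_)
  rw [SimpleGraph.fromRel_adj]
  exact ⟨((F.s_iff u v).1 h).1.ne, Or.inl h⟩

lemma node_eq_of_adj (F : ConvexFrame G x y r s P) {u v : V} (h : G.Adj u v) (hx : x u = x v) :
    node s u = node s v :=
  (F.s_or_s h hx).elim F.node_eq_of_s fun h => (F.node_eq_of_s h).symm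

/-- A property that is inherited along vertical edges holds on a whole node. -/
lemma node_induction {p : V → Prop} {u v : V}
    (h : node s u = node s v) (hu : p u)
    (hs : ∀ a b, node s a = node s u → p a → s a b ∨ s b a → p b) : p v := by
  have h' := SimpleGraph.ConnectedComponent.exact h
  rw [SimpleGraph.reachable_iff_reflTransGen] at h'
  suffices node s u = node s v ∧ p v from this.2
  clear h
  induction h' with
  | refl => exact ⟨rfl, hu⟩
  | @tail b c _ hbc ih =>
    refine ⟨ih.1.trans (SimpleGraph.ConnectedComponent.sound hbc.reachable), ?_⟩
    rw [SimpleGraph.fromRel_adj] at hbc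
    exact hs b c ih.1.symm ih.2 hbc.2

lemma x_eq_of_node (F : ConvexFrame G x y r s P) {u v : V} (h : node s u = node s v) :
    x u = x v :=
  node_induction (p := fun v => x u = x v) h rfl fun _ _ _ ha hab =>
    ha.trans (hab.elim F.x_eq_of_s fun h => (F.x_eq_of_s h).symm)

/-- The point `(a, b)` lies on the vertical path that forms the node `C`. -/
def OnNode (x y : V → ℝ) (s : V → V → Prop) (C : (SimpleGraph.fromRel s).ConnectedComponent)
    (a b : ℝ) : Prop :=
  ∃ u v, node s u = C ∧ (u = v ∨ s u v) ∧ x u = a ∧ y u ≤ b ∧ b ≤ y v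

lemma onNode_vertex (v : V) : OnNode x y s (node s v) (x v) (y v) :=
  ⟨v, v, rfl, Or.inl rfl, rfl, le_rfl, le_rfl⟩

lemma onNode_edge {u v : V} (h : s u v) {b : ℝ} (h1 : y u ≤ b) (h2 : b ≤ y v) :
    OnNode x y s (node s u) (x u) b :=
  ⟨u, v, rfl, Or.inr h, rfl, h1, h2⟩

/-- The element of the drawing behind a point on a node. -/
lemma OnNode.exists_box (F : ConvexFrame G x y r s P)
    {C : (SimpleGraph.fromRel s).ConnectedComponent} {a b : ℝ} (h : OnNode x y s C a b) :
    ∃ u v, node s u = C ∧ node s v = C ∧ x u = a ∧ x v = a ∧ (u = v ∨ G.Adj u v) ∧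
      InBox x y u v a b := by
  obtain ⟨u, v, rfl, h1, rfl, h2, h3⟩ := h
  have hb : b ∈ Set.uIcc (y u) (y v) := Set.mem_uIcc.2 (Or.inl ⟨h2, h3⟩)
  rcases h1 with rfl | h1
  · exact ⟨u, u, rfl, rfl, rfl, rfl, Or.inl rfl, by simp, hb⟩
  · exact ⟨u, v, rfl, (F.node_eq_of_s h1).symm, rfl, (F.x_eq_of_s h1).symm,
      Or.inr ((F.s_iff u v).1 h1).1, Set.left_mem_uIcc, hb⟩

lemma OnNode.covered (F : ConvexFrame G x y r s P)
    {C : (SimpleGraph.fromRel s).ConnectedComponent} {a b : ℝ} (h : OnNode x y s C a b) :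
    Covered G x y a b := by
  obtain ⟨u, v, -, -, -, -, h1, h2⟩ := OnNode.exists_box F h
  exact ⟨u, v, h1, h2⟩

lemma OnNode.unique (F : ConvexFrame G x y r s P)
    {C C' : (SimpleGraph.fromRel s).ConnectedComponent} {a b : ℝ} (h : OnNode x y s C a b)
    (h' : OnNode x y s C' a b) : C = C' := by
  obtain ⟨u, v, hu, hv, -, -, h1, h2⟩ := OnNode.exists_box F h
  obtain ⟨u', v', hu', hv', -, -, h1', h2'⟩ := OnNode.exists_box F h'
  rcases F.meet u v u' v' h1 h1' a b h2 h2' with he | ⟨w, hw, hw', -⟩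
  · rcases Sym2.eq_iff.1 he with ⟨rfl, rfl⟩ | ⟨rfl, rfl⟩
    · exact hu.symm.trans hu'
    · exact hu.symm.trans hv'
  · rcases hw with rfl | rfl <;> rcases hw' with rfl | rfl <;> simp_all

/-- A horizontal edge meets a node only in an end of the edge. -/
lemma OnNode.meet_horizontal (F : ConvexFrame G x y r s P)
    {C : (SimpleGraph.fromRel s).ConnectedComponent} {a b : ℝ} (h : OnNode x y s C a b) {u v : V}
    (huv : r u v) (h1 : x u ≤ a) (h2 : a ≤ x v) (h3 : y u = b) :
    ∃ w, (w = u ∨ w = v) ∧ x w = a ∧ node s w = C := by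
  obtain ⟨u', v', hu', hv', xu', xv', h1', h2'⟩ := OnNode.exists_box F h
  have hadj := (F.r_iff u v).1 huv
  have hbox : InBox x y u v a b :=
    ⟨Set.mem_uIcc.2 (Or.inl ⟨h1, h2⟩), by rw [← h3]; exact Set.left_mem_uIcc⟩
  rcases F.meet u v u' v' (Or.inr hadj.1) h1' a b hbox h2' with he | ⟨w, hw, hw', hxw, -⟩
  · exfalso
    rcases Sym2.eq_iff.1 he with ⟨rfl, rfl⟩ | ⟨rfl, rfl⟩ <;> linarith [hadj.2]
  · refine ⟨w, hw, hxw, ?_⟩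
    rcases hw' with rfl | rfl <;> assumption

lemma onNode_of_between (F : ConvexFrame G x y r s P) {u v : V} (h : node s u = node s v) {b : ℝ}
    (h1 : y u ≤ b) (h2 : b ≤ y v) : OnNode x y s (node s u) (x u) b := by
  have key := node_induction (p := fun v => ∀ b, y u ≤ b → b ≤ y v →
    OnNode x y s (node s u) (x u) b) h ?_ ?_
  · exact key b h1 h2
  · intro b h1 h2
    exact ⟨u, u, rfl, Or.inl rfl, rfl, h1, h2⟩
  · intro v w hv ih hvw b h1 h2
    by_cases hb : b ≤ y v
    · exact ih b h1 hb
    · push Not at hb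
      have hs : s v w := by
        refine hvw.resolve_right fun hs => ?_
        have := ((F.s_iff w v).1 hs).2
        linarith
      have hx := F.x_eq_of_node hv
      exact ⟨v, w, hv, Or.inr hs, hx, hb.le, h2⟩

/-! ### Walking through faces -/

variable [Finite V]

lemma exists_gap_above (f : V → ℝ) (t : ℝ) : ∃ ε > 0, ∀ v, t < f v → t + ε ≤ f v := by
  rcases Set.eq_empty_or_nonempty {v | t < f v} with h | h
  · refine ⟨1, one_pos, fun v hv => ?_⟩
    have : v ∈ {v | t < f v} := hv
    simp [h] at this
  · obtain ⟨v, hv, hmin⟩ := Set.exists_min_image _ f (Set.toFinite _) h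
    have hv' : t < f v := hv
    exact ⟨f v - t, by linarith, fun w hw => by linarith [hmin w hw]⟩

lemma ncard_above_lt (f : V → ℝ) {t : ℝ} {v : V} (h : t < f v) :
    {w | f v < f w}.ncard < {w | t < f w}.ncard := by
  refine Set.ncard_lt_ncard ?_ (Set.toFinite _)
  refine ⟨fun w hw => lt_trans h hw, fun hsub => ?_⟩
  have : f v < f v := hsub (show v ∈ {w | t < f w} from h)
  exact lt_irrefl _ this

/-- Points of the drawing just right of `(a, b)` lie on an edge that also contains `(a, b)`. -/
lemma exists_right_edge (F : ConvexFrame G x y r s P) (a b : ℝ) :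
    ∃ ε > 0, ∀ a', a < a' → a' < a + ε → Covered G x y a' b →
      ∃ u v, r u v ∧ y u = b ∧ x u ≤ a ∧ a < x v := by
  obtain ⟨ε, hε, hgap⟩ := exists_gap_above x a
  refine ⟨ε, hε, fun a' h1 h2 => ?_⟩
  have hne : ∀ v, x v ≠ a' := fun v hv => by
    have := hgap v (by linarith)
    linarith
  have key : ∀ u v, r u v → InBox x y u v a' b → ∃ u v, r u v ∧ y u = b ∧ x u ≤ a ∧ a < x v := by
    rintro u v huv ⟨hx, hy⟩
    have hlt := ((F.r_iff u v).1 huv).2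
    rw [← F.y_eq_of_r huv, Set.uIcc_self, Set.mem_singleton_iff] at hy
    rw [Set.uIcc_of_le hlt.le] at hx
    refine ⟨u, v, huv, hy.symm, ?_, by linarith [hx.2]⟩
    by_contra hu
    have := hgap u (not_le.1 hu)
    linarith [hx.1]
  rintro ⟨u, v, rfl | hadj, hbox⟩
  · have := hbox.1
    simp only [Set.uIcc_self, Set.mem_singleton_iff] at this
    exact absurd this.symm (hne u)
  · rcases F.adj_cases hadj with (h | h) | h
    · exact key u v h hbox
    · exact key v u h hbox.comm
    · have hx : x u = x v := h.elim F.x_eq_of_s fun h => (F.x_eq_of_s h).symm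
      have := hbox.1
      rw [← hx] at this
      simp only [Set.uIcc_self, Set.mem_singleton_iff] at this
      exact absurd this.symm (hne u)

lemma exists_up_edge_of_covered (F : ConvexFrame G x y r s P) {a b b' : ℝ} (hb : b < b')
    (h : ∀ t, b ≤ t → t ≤ b' → Covered G x y a t) : ∃ u v, s u v ∧ x u = a ∧ y u ≤ b ∧ b < y v := by
  obtain ⟨ε, hε, hup⟩ := F.swap.exists_right_edge b a
  have hm : b < min b' (b + ε / 2) := lt_min hb (by linarith)
  exact hup _ hm (lt_of_le_of_lt (min_le_right _ _) (by linarith))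
    (covered_swap_iff.2 (h _ hm.le (min_le_left _ _)))

/-- A node contains every vertical segment of the drawing that starts on it. -/
lemma onNode_of_covered (F : ConvexFrame G x y r s P)
    {C : (SimpleGraph.fromRel s).ConnectedComponent} {a b b' : ℝ} (hC : OnNode x y s C a b)
    (hb : b ≤ b') (h : ∀ t, b ≤ t → t ≤ b' → Covered G x y a t) : OnNode x y s C a b' := by
  induction hn : {v | b < y v}.ncard using Nat.strong_induction_on generalizing b with
  | _ n ih =>
    rcases hb.eq_or_lt with rfl | hlt
    · exact hC
    obtain ⟨u, v, huv, rfl, hu, hv⟩ := F.exists_up_edge_of_covered hlt h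
    have hCu : node s u = C := (onNode_edge huv hu hv.le).unique F hC
    by_cases hbv : b' ≤ y v
    · exact hCu ▸ onNode_edge huv (hu.trans hb) hbv
    · have hCv : OnNode x y s C (x u) (y v) := by
        rw [← hCu]
        exact onNode_edge huv (hu.trans hv.le) le_rfl
      exact ih _ (hn ▸ ncard_above_lt y hv) hCv (not_le.1 hbv).le
        (fun t h1 h2 => h t (hv.le.trans h1) h2) rfl

omit [Finite V] in
/-- Following a horizontal edge to the right from one node towards another one. -/
lemma right_step (F : ConvexFrame G x y r s P)
    {C C' : (SimpleGraph.fromRel s).ConnectedComponent} {a a' b : ℝ} (hC : OnNode x y s C a b)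
    (hC' : OnNode x y s C' a' b) (ha : a < a') {u v : V} (huv : r u v) (hy : y u = b)
    (hu : x u ≤ a) (hv : a < x v) :
    (contractedDigraph r s).Adj C (node s v) ∧ x v ≤ a' ∧ OnNode x y s (node s v) (x v) b := by
  refine ⟨?_, ?_, ?_⟩
  · obtain ⟨w, rfl | rfl, hw, hwC⟩ := hC.meet_horizontal F huv hu hv.le hy
    · exact ⟨w, v, huv, hwC, rfl⟩
    · linarith
  · by_contra hlt
    push Not at hlt
    obtain ⟨w, rfl | rfl, hw, -⟩ := hC'.meet_horizontal F huv (by linarith) hlt.le hy <;> linarith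
  · rw [← hy, F.y_eq_of_r huv]
    exact onNode_vertex v

lemma reach_of_covered (F : ConvexFrame G x y r s P)
    {C C' : (SimpleGraph.fromRel s).ConnectedComponent} {a a' b : ℝ} (hC : OnNode x y s C a b)
    (hC' : OnNode x y s C' a' b) (ha : a ≤ a') (h : ∀ t, a ≤ t → t ≤ a' → Covered G x y t b) :
    Relation.ReflTransGen (contractedDigraph r s).Adj C C' := by
  induction hn : {v | a < x v}.ncard using Nat.strong_induction_on generalizing a C with
  | _ n ih =>
    rcases ha.eq_or_lt with rfl | hlt
    · rw [hC.unique F hC']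
    obtain ⟨u, v, huv, hy, hu, hv⟩ := F.swap.exists_up_edge_of_covered hlt
      (fun t h1 h2 => covered_swap_iff.2 (h t h1 h2))
    obtain ⟨h1, h2, h3⟩ := F.right_step hC hC' hlt huv hy hu hv
    exact .head h1 (ih _ (hn ▸ ncard_above_lt x hv) h3 h2
      (fun t h1 h2 => h t (hv.le.trans h1) h2) rfl)

/-- Two nodes that meet a common horizontal line are comparable in the contracted digraph: the
segment between them lies in the region, and a directed path follows the edges it contains and the
upper sides of the rectangular faces it crosses. -/
theorem reach_of_onNode (F : ConvexFrame G x y r s P)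
    {C C' : (SimpleGraph.fromRel s).ConnectedComponent} {a a' b : ℝ} (hC : OnNode x y s C a b)
    (hC' : OnNode x y s C' a' b) (ha : a ≤ a') :
    Relation.ReflTransGen (contractedDigraph r s).Adj C C' := by
  induction hn : {v | a < x v}.ncard using Nat.strong_induction_on generalizing a C with
  | _ n ih =>
    rcases ha.eq_or_lt with rfl | hlt
    · rw [hC.unique F hC']
    by_cases hstep : ∃ u v, r u v ∧ y u = b ∧ x u ≤ a ∧ a < x v
    · obtain ⟨u, v, huv, hy, hu, hv⟩ := hstep
      obtain ⟨h1, h2, h3⟩ := F.right_step hC hC' hlt huv hy hu hv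
      exact .head h1 (ih _ (hn ▸ ncard_above_lt x hv) h3 h2 rfl)
    obtain ⟨ε, hε, hright⟩ := F.exists_right_edge a b
    have hnc : ∀ t, a < t → t < a + ε → ¬ Covered G x y t b :=
      fun t h1 h2 h3 => hstep (hright t h1 h2 h3)
    -- Nothing is drawn just right of `(a, b)`, so the next point of the line lies in a face, whose
    -- left side is on `C` and whose right side is on the node of `u` below.
    set z := min a' (a + ε / 2) with hz
    have haz : a < z := lt_min hlt (by linarith)
    have hzε : z < a + ε := lt_of_le_of_lt (min_le_right _ _) (by linarith)
    have hPz : P z b := F.conv_h a z a' b (F.sub _ _ (hC.covered F)) (F.sub _ _ (hC'.covered F))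
      haz.le (min_le_left _ _)
    obtain ⟨a₁, a₂, b₁, b₂, h1, h2, h3, h4, hint, hh, hv⟩ := F.face z b hPz (hnc z haz hzε)
    have ha₁ : a₁ = a := by
      rcases lt_trichotomy a₁ a with h | h | h
      · exact absurd (hC.covered F) (hint a b h (haz.trans h2) h3 h4)
      · exact h
      · exact absurd (hv b h3.le h4.le).1 (hnc a₁ h (h1.trans hzε))
    subst ha₁
    have ha₂ : a₂ ≤ a' := by
      by_contra hcon
      exact hint a' b hlt (not_le.1 hcon) h3 h4 (hC'.covered F)
    obtain ⟨u, v, huv, hxu, hyu, hyv⟩ := F.exists_up_edge_of_covered (a := a₂) h4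
      (fun t k1 k2 => (hv t (h3.le.trans k1) k2).2)
    have hD : OnNode x y s (node s u) a₂ b := hxu ▸ onNode_edge huv hyu hyv.le
    refine Relation.ReflTransGen.trans ?_ (ih {v | a₂ < x v}.ncard ?_ hD ha₂ rfl)
    · exact F.reach_of_covered
        (F.onNode_of_covered hC h4.le fun t k1 k2 => (hv t (h3.le.trans k1) k2).1)
        (F.onNode_of_covered hD h4.le fun t k1 k2 => (hv t (h3.le.trans k1) k2).2)
        (h1.trans h2).le (fun t k1 k2 => (hh t k1 k2).2)
    · rw [← hn, ← hxu]
      exact ncard_above_lt x (hxu ▸ h1.trans h2)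

/-! ### Quadrants -/

omit [Finite V] in
lemma quadrant_closed (F : ConvexFrame G x y r s P) {a b : ℝ} (h2 : ∀ t, b < t → ¬ P a t) {u v : V}
    (hu : a < x u ∧ b < y u) (hadj : G.Adj u v) (hy : y u = y v) : a < x v ∧ b < y v := by
  refine ⟨?_, hy ▸ hu.2⟩
  by_contra hv
  refine h2 _ hu.2 (F.sub _ _ ⟨u, v, Or.inr hadj, ?_, Set.left_mem_uIcc⟩)
  exact Set.mem_uIcc.2 (Or.inr ⟨not_lt.1 hv, hu.1.le⟩)

omit [Finite V] in
/-- No edge enters an open quadrant whose two sides lie outside the region; since the graph is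
connected, such a quadrant contains no vertex unless it contains all of them. -/
lemma not_mem_quadrant (F : ConvexFrame G x y r s P) {a b : ℝ}
    (h1 : ∀ t, a < t → ¬ P t b) (h2 : ∀ t, b < t → ¬ P a t) {p : V} (q : V)
    (hp : ¬ (a < x p ∧ b < y p)) : ¬ (a < x q ∧ b < y q) := by
  intro hq
  have hreach := F.conn.preconnected q p
  rw [SimpleGraph.reachable_iff_reflTransGen] at hreach
  refine hp ?_
  clear hp
  induction hreach with
  | refl => exact hq
  | @tail u v _ huv ih =>
    rcases F.axis u v huv with h | h
    · exact (F.swap.quadrant_closed h1 ih.symm huv h).symm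
    · exact F.quadrant_closed h2 ih huv h

omit [Finite V] in
lemma eq_left_of_mem (F : ConvexFrame G x y r s P) {u v w : V} (huv : r u v) (hy : y w = y u)
    (h1 : x u ≤ x w) (h2 : x w < x v) : w = u := by
  obtain ⟨w', hw', hx, hn⟩ := (onNode_vertex (s := s) w).meet_horizontal F huv h1 h2.le hy.symm
  rcases hw' with rfl | rfl
  · exact F.inj _ _ hx.symm hy
  · exact absurd hx h2.ne'

/-- A vertex without neighbours to the right and above is a corner of the external polygon:
the horizontal ray to its right is outside the region. -/
lemma not_mem_right_of_corner (F : ConvexFrame G x y r s P) {p : V} (hr : ∀ v, ¬ r p v)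
    (hs : ∀ v, ¬ s p v) (t : ℝ) (ht : x p < t) : ¬ P t (y p) := by
  intro hP
  obtain ⟨ε, hε, hright⟩ := F.exists_right_edge (x p) (y p)
  have hnc : ∀ t, x p < t → t < x p + ε → ¬ Covered G x y t (y p) := by
    intro t h1 h2 h3
    obtain ⟨u, v, huv, hy, hu, hv⟩ := hright t h1 h2 h3
    obtain rfl := F.eq_left_of_mem huv hy.symm hu hv
    exact hr v huv
  -- Otherwise a face lies to the right of `p`, and its left side contains an edge upwards from `p`.
  set z := min t (x p + ε / 2) with hz
  have hpz : x p < z := lt_min ht (by linarith)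
  have hzε : z < x p + ε := lt_of_le_of_lt (min_le_right _ _) (by linarith)
  have hPz : P z (y p) := F.conv_h _ z t _ (F.sub _ _ (covered_vertex p)) hP hpz.le (min_le_left _ _)
  obtain ⟨a₁, a₂, b₁, b₂, h1, h2, h3, h4, hint, hh, hv⟩ := F.face z _ hPz (hnc z hpz hzε)
  have ha₁ : a₁ = x p := by
    rcases lt_trichotomy a₁ (x p) with h | h | h
    · exact absurd (covered_vertex p) (hint _ _ h (hpz.trans h2) h3 h4)
    · exact h
    · exact absurd (hv _ h3.le h4.le).1 (hnc a₁ h (h1.trans hzε))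
  subst ha₁
  obtain ⟨u, v, huv, hx, hu, hv⟩ := F.exists_up_edge_of_covered h4
    (fun t k1 k2 => (hv t (h3.le.trans k1) k2).1)
  obtain rfl := F.swap.eq_left_of_mem huv hx.symm hu hv
  exact hs v huv

/-- A vertex without neighbours to the right and above is alone in its closed upper right
quadrant. -/
lemma eq_of_corner (F : ConvexFrame G x y r s P) {p q : V} (hr : ∀ v, ¬ r p v)
    (hs : ∀ v, ¬ s p v) (hx : x p ≤ x q) (hy : y p ≤ y q) : q = p := by
  have h1 := F.not_mem_right_of_corner hr hs
  have h2 := F.swap.not_mem_right_of_corner hs hr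
  rcases hx.eq_or_lt with hx | hx
  · rcases hy.eq_or_lt with hy | hy
    · exact (F.inj _ _ hx hy).symm
    · exact absurd (F.sub _ _ (hx ▸ covered_vertex q)) (h2 _ hy)
  · rcases hy.eq_or_lt with hy | hy
    · exact absurd (F.sub _ _ (hy ▸ covered_vertex q)) (h1 _ hx)
    · exact absurd ⟨hx, hy⟩ (F.not_mem_quadrant h1 h2 (p := p) q (by simp))

omit [Finite V] in
lemma exists_vertex_of_covered (F : ConvexFrame G x y r s P) {a b : ℝ} (h : Covered G x y a b) :
    ∃ v, x v = a ∨ y v = b := by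
  obtain ⟨u, v, h, hx, hy⟩ := h
  rcases h with rfl | h
  · exact ⟨u, Or.inl (by rw [Set.uIcc_self] at hx; exact (Set.mem_singleton_iff.1 hx).symm)⟩
  · rcases F.axis u v h with h | h
    · rw [← h] at hx
      exact ⟨u, Or.inl (by rw [Set.uIcc_self] at hx; exact (Set.mem_singleton_iff.1 hx).symm)⟩
    · rw [← h] at hy
      exact ⟨u, Or.inr (by rw [Set.uIcc_self] at hy; exact (Set.mem_singleton_iff.1 hy).symm)⟩

omit [Finite V] in
lemma covered_of_r (F : ConvexFrame G x y r s P) {u v : V} (h : r u v) {a : ℝ} (h1 : x u ≤ a)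
    (h2 : a ≤ x v) : Covered G x y a (y u) :=
  ⟨u, v, Or.inr ((F.r_iff u v).1 h).1, Set.mem_uIcc.2 (Or.inl ⟨h1, h2⟩), Set.left_mem_uIcc⟩

/-- A face to the right of and above `p` extends at least to the right end of the edge at `p`. -/
lemma right_le_of_face (F : ConvexFrame G x y r s P) {p v : V} (hr : r p v) {a b : ℝ}
    (ha : x p < a) (hb : y p < b) (h : ∀ t, y p ≤ t → t ≤ b → Covered G x y a t) : x v ≤ a := by
  by_contra hlt
  push Not at hlt
  obtain ⟨u, u', huv, hx, hu, hv⟩ := F.exists_up_edge_of_covered hb h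
  obtain ⟨w, hw, hxw, -⟩ := (onNode_edge (x := x) huv hu hv.le).meet_horizontal F hr
    (by linarith) (by linarith) rfl
  rcases hw with rfl | rfl <;> linarith

/-- If `p` has neighbours to the right and above, then its upper right quadrant contains no vertex
that is both left of the former and below the latter. -/
lemma not_mem_corner_box (F : ConvexFrame G x y r s P) {p q v w : V} (hr : r p v) (hs : s p w)
    (hqp : q ≠ p) (hx : x p ≤ x q) (hy : y p ≤ y q) : x v ≤ x q ∨ y w ≤ y q := by
  by_contra! hcon
  obtain ⟨hxv, hyw⟩ := hcon
  have hxp : x p < x q := by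
    refine lt_of_le_of_ne hx fun h => hqp ?_
    exact F.swap.eq_left_of_mem hs h.symm hy hyw
  have hyp : y p < y q := by
    refine lt_of_le_of_ne hy fun h => hqp ?_
    exact F.eq_left_of_mem hr h.symm hx hxv
  obtain ⟨ε₁, hε₁, hg₁⟩ := exists_gap_above x (x p)
  obtain ⟨ε₂, hε₂, hg₂⟩ := exists_gap_above y (y p)
  have hnc : ∀ a b, x p < a → a < x p + ε₁ → y p < b → b < y p + ε₂ → ¬ Covered G x y a b := by
    intro a b h1 h2 h3 h4 hc
    obtain ⟨u, hu | hu⟩ := F.exists_vertex_of_covered hc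
    · linarith [hg₁ u (by linarith)]
    · linarith [hg₂ u (by linarith)]
  have hq₁ := hg₁ q hxp
  have hq₂ := hg₂ q hyp
  set z₁ := x p + ε₁ / 2 with hz₁
  set z₂ := y p + ε₂ / 2 with hz₂
  have c₁ : Covered G x y z₁ (y p) := F.covered_of_r hr (by linarith) (by linarith)
  have c₂ : Covered G x y (x p) z₂ :=
    covered_swap_iff.1 (F.swap.covered_of_r hs (by linarith) (by linarith))
  have hzz : ¬ Covered G x y z₁ z₂ :=
    hnc _ _ (by linarith) (by linarith) (by linarith) (by linarith)
  -- The point `(z₁, z₂)` is so close to `p` that nothing is drawn between it and the edges at `p`.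
  -- It lies either in a face, which contains the whole box of the two edges, or outside the region,
  -- and then so do the rays to its right and above it.
  by_cases hP : P z₁ z₂
  · obtain ⟨a₁, a₂, b₁, b₂, h1, h2, h3, h4, hint, hh, hv⟩ := F.face _ _ hP hzz
    have ha₁ : a₁ = x p := by
      rcases lt_trichotomy a₁ (x p) with h | h | h
      · exact absurd c₂ (hint _ _ h (by linarith) h3 h4)
      · exact h
      · exact absurd (hv _ h3.le h4.le).1
          (hnc _ _ h (by linarith) (by linarith) (by linarith))
    have hb₁ : b₁ = y p := by
      rcases lt_trichotomy b₁ (y p) with h | h | h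
      · exact absurd c₁ (hint _ _ h1 h2 h (by linarith))
      · exact h
      · exact absurd (hh _ h1.le h2.le).1
          (hnc _ _ (by linarith) (by linarith) h (by linarith))
    subst ha₁ hb₁
    have ha₂ := F.right_le_of_face hr (h1.trans h2) (h3.trans h4) fun t k1 k2 => (hv t k1 k2).2
    have hb₂ := F.swap.right_le_of_face hs (h3.trans h4) (h1.trans h2)
      fun t k1 k2 => covered_swap_iff.2 (hh t k1 k2).2
    exact hint _ _ hxp (by linarith) hyp (by linarith) (covered_vertex q)
  · refine F.not_mem_quadrant (a := z₁) (b := z₂) ?_ ?_ (p := p) q ?_ ⟨by linarith, by linarith⟩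
    · intro t ht hPt
      exact hP (F.conv_h _ z₁ t _ (F.sub _ _ c₂) hPt (by linarith) ht.le)
    · intro t ht hPt
      exact hP (F.conv_v _ _ z₂ t (F.sub _ _ c₁) hPt (by linarith) ht.le)
    · intro h
      linarith [h.1]

end ConvexFrame

/-! ### Other drawings of the same representation -/

/-- Coordinates `X`, `Y` in which every edge has the direction given by `r` and `s`. -/
structure Compatible (r s : V → V → Prop) (X Y : V → ℝ) : Prop where
  lt_of_r : ∀ {u v}, r u v → X u < X v
  eq_of_s : ∀ {u v}, s u v → X u = X v
  lt_of_s : ∀ {u v}, s u v → Y u < Y v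
  eq_of_r : ∀ {u v}, r u v → Y u = Y v

namespace Compatible

variable {r s : V → V → Prop} {X Y : V → ℝ}

lemma swap (c : Compatible r s X Y) : Compatible s r Y X := ⟨c.lt_of_s, c.eq_of_r, c.lt_of_r, c.eq_of_s⟩

lemma negy (c : Compatible r s X Y) : Compatible r (fun u v => s v u) X (fun v => -Y v) :=
  ⟨c.lt_of_r, fun h => (c.eq_of_s h).symm, fun h => neg_lt_neg (c.lt_of_s h),
    fun h => congrArg _ (c.eq_of_r h)⟩

lemma eq_of_node (c : Compatible r s X Y) {u v : V}
    (h : ConvexFrame.node s u = ConvexFrame.node s v) : X u = X v :=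
  ConvexFrame.node_induction (p := fun v => X u = X v) h rfl fun _ _ _ ha hab =>
    ha.trans (hab.elim c.eq_of_s fun h => (c.eq_of_s h).symm)

lemma lt_of_transGen (c : Compatible r s X Y) {C C' : (SimpleGraph.fromRel s).ConnectedComponent}
    (h : Relation.TransGen (contractedDigraph r s).Adj C C') {u v : V}
    (hu : ConvexFrame.node s u = C) (hv : ConvexFrame.node s v = C') : X u < X v := by
  induction h generalizing v with
  | single h =>
    obtain ⟨u', v', h, h1, h2⟩ := h
    rw [c.eq_of_node (hu.trans h1.symm), c.eq_of_node (hv.trans h2.symm)]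
    exact c.lt_of_r h
  | tail _ h ih =>
    obtain ⟨u', v', h, h1, h2⟩ := h
    rw [c.eq_of_node (hv.trans h2.symm)]
    exact (ih h1).trans (c.lt_of_r h)

end Compatible

namespace ConvexFrame

variable {G : SimpleGraph V} {x y : V → ℝ} {r s : V → V → Prop} {P : ℝ → ℝ → Prop}

lemma compatible (F : ConvexFrame G x y r s P) : Compatible r s x y :=
  ⟨fun h => ((F.r_iff _ _).1 h).2, F.x_eq_of_s, fun h => ((F.s_iff _ _).1 h).2, F.y_eq_of_r⟩

variable [Finite V] {X Y : V → ℝ}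

/-- Nodes that meet a common horizontal line keep their left-to-right order. -/
lemma lt_of_onNode (F : ConvexFrame G x y r s P) (c : Compatible r s X Y) {u v : V} {a a' b : ℝ}
    (hu : OnNode x y s (node s u) a b) (hv : OnNode x y s (node s v) a' b) (h : a < a') :
    X u < X v := by
  have hne : node s v ≠ node s u := by
    intro he
    obtain ⟨u', -, hu', -, rfl, -⟩ := hu
    obtain ⟨v', -, hv', -, rfl, -⟩ := hv
    exact h.ne (F.x_eq_of_node (hu'.trans (he.symm.trans hv'.symm)))
  have := F.reach_of_onNode hu hv h.le
  rcases Relation.reflTransGen_iff_eq_or_transGen.1 this with he | ht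
  · exact absurd he hne
  · exact c.lt_of_transGen ht rfl rfl

/-- If `p` is above and to the left of `q`, then every drawing keeps one of these two relations:
walking from `p` to the right and down, one passes the vertical or the horizontal line through `q`,
since a vertex where the walk got stuck would be alone in its lower right quadrant. -/
lemma lt_or_lt_of_above_left (F : ConvexFrame G x y r s P) (c : Compatible r s X Y) {p q : V}
    (hx : x p < x q) (hy : y q < y p) : X p < X q ∨ Y q < Y p := by
  induction hn : {v | x p < x v}.ncard + {v | -y p < -y v}.ncard using Nat.strong_induction_on
    generalizing p with
  | _ n ih =>
    by_cases hr : ∃ v, r p v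
    · obtain ⟨v, hv⟩ := hr
      have hpv := F.compatible.lt_of_r hv
      have hyv := F.y_eq_of_r hv
      rcases lt_or_ge (x v) (x q) with h | h
      · have hlt := ncard_above_lt x hpv
        rcases ih _ (by rw [← hn, hyv]; omega) h (hyv ▸ hy) rfl with h | h
        · exact Or.inl ((c.lt_of_r hv).trans h)
        · exact Or.inr (by rwa [c.eq_of_r hv])
      · exact Or.inr (F.swap.lt_of_onNode c.swap (onNode_vertex q)
          (onNode_edge hv hx.le h) hy)
    by_cases hs : ∃ v, s v p
    · obtain ⟨v, hv⟩ := hs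
      have hpv := F.compatible.lt_of_s hv
      have hxv := F.x_eq_of_s hv
      rcases lt_or_ge (y q) (y v) with h | h
      · have hlt := ncard_above_lt (fun v => -y v) (neg_lt_neg hpv)
        rcases ih _ (by rw [← hn, hxv]; omega) (hxv ▸ hx) h rfl with h | h
        · exact Or.inl (by rwa [← c.eq_of_s hv])
        · exact Or.inr (h.trans (c.lt_of_s hv))
      · rw [← c.eq_of_s hv]
        exact Or.inl (F.lt_of_onNode c (onNode_edge hv h hy.le)
          (onNode_vertex q) (hxv ▸ hx))
    · push Not at hr hs
      have := F.negy.eq_of_corner hr hs hx.le (neg_le_neg hy.le)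
      subst this
      exact absurd hx (lt_irrefl _)

lemma lt_or_lt_of_below_left (F : ConvexFrame G x y r s P) (c : Compatible r s X Y) {p q : V}
    (hx : x p < x q) (hy : y p < y q) : X p < X q ∨ Y p < Y q :=
  (F.negy.lt_or_lt_of_above_left c.negy hx (neg_lt_neg hy)).imp id neg_lt_neg_iff.1

omit [Finite V] in
/-- The lower right corner of an edge, as a vertex, and the right side of the edge. -/
lemma exists_lower_right (F : ConvexFrame G x y r s P) (c : Compatible r s X Y) {u v : V}
    (h : u = v ∨ r u v ∨ s u v) : ∃ p, x p = x v ∧ y p = y u ∧ X p = X v ∧ Y p = Y u ∧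
      node s p = node s v := by
  rcases h with rfl | h | h
  · exact ⟨u, rfl, rfl, rfl, rfl, rfl⟩
  · exact ⟨v, rfl, (F.y_eq_of_r h).symm, rfl, (c.eq_of_r h).symm, rfl⟩
  · exact ⟨u, F.x_eq_of_s h, rfl, c.eq_of_s h, rfl, F.node_eq_of_s h⟩

omit [Finite V] in
lemma exists_upper_left (F : ConvexFrame G x y r s P) (c : Compatible r s X Y) {u v : V}
    (h : u = v ∨ r u v ∨ s u v) : ∃ p, x p = x u ∧ y p = y v ∧ X p = X u ∧ Y p = Y v ∧
      node s p = node s u := by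
  rcases h with rfl | h | h
  · exact ⟨u, rfl, rfl, rfl, rfl, rfl⟩
  · exact ⟨u, rfl, F.y_eq_of_r h, rfl, c.eq_of_r h, rfl⟩
  · exact ⟨v, (F.x_eq_of_s h).symm, rfl, (c.eq_of_s h).symm, rfl, (F.node_eq_of_s h).symm⟩

/-- Two vertices or edges (each given with its lower left end first) that are separated by a
vertical line do not meet in any other drawing. -/
lemma le_of_boxes_meet_aux (F : ConvexFrame G x y r s P) (c : Compatible r s X Y) {u v u' v' : V}
    (h : u = v ∨ r u v ∨ s u v) (h' : u' = v' ∨ r u' v' ∨ s u' v')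
    (hX : X u' ≤ X v) (hY : Y u ≤ Y v') (hY' : Y u' ≤ Y v) : x u' ≤ x v := by
  by_contra! hlt
  rcases lt_or_ge (y v) (y u') with h1 | h1
  · rcases F.lt_or_lt_of_below_left c hlt h1 with h | h <;> linarith
  -- If a common horizontal line exists, the right side of the one and the left side of the other
  -- are comparable nodes; otherwise corners that face each other are compared.
  obtain ⟨p, xp, yp, Xp, Yp, np⟩ := F.exists_lower_right c h
  obtain ⟨q, xq, yq, Xq, Yq, nq⟩ := F.exists_upper_left c h'
  rcases lt_or_ge (y v') (y u) with h2 | h2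
  · rcases F.lt_or_lt_of_above_left c (p := p) (q := q) (by rwa [xp, xq]) (by rwa [yp, yq]) with
      h | h <;> linarith
  have hle : ∀ {u v : V}, u = v ∨ r u v ∨ s u v → y u ≤ y v := by
    rintro u v (rfl | h | h)
    · exact le_rfl
    · exact (F.y_eq_of_r h).le
    · exact (F.compatible.lt_of_s h).le
  have k1 := F.onNode_of_between np (b := max (y u) (y u')) (yp ▸ le_max_left _ _)
    (max_le (hle h) h1)
  have k2 := F.onNode_of_between nq.symm (b := max (y u) (y u')) (le_max_right _ _)
    (yq ▸ max_le h2 (hle h'))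
  have := F.lt_of_onNode c k1 k2 (by rwa [xp])
  linarith

/-- Vertices or edges that meet in some drawing with the same edge directions meet in the given
one. -/
lemma inBox_of_inBox (F : ConvexFrame G x y r s P) (c : Compatible r s X Y) {u v u' v' : V}
    (h : u = v ∨ G.Adj u v) (h' : u' = v' ∨ G.Adj u' v') {a b : ℝ} (hb : InBox X Y u v a b)
    (hb' : InBox X Y u' v' a b) : ∃ a b, InBox x y u v a b ∧ InBox x y u' v' a b := by
  have key : ∀ u v u' v', (u = v ∨ r u v ∨ s u v) → (u' = v' ∨ r u' v' ∨ s u' v') →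
      InBox X Y u v a b → InBox X Y u' v' a b →
      ∃ a b, InBox x y u v a b ∧ InBox x y u' v' a b := by
    intro u v u' v' h h' hb hb'
    have hle : ∀ {X Y : V → ℝ} (_ : Compatible r s X Y) {u v : V}, u = v ∨ r u v ∨ s u v →
        X u ≤ X v ∧ Y u ≤ Y v := by
      rintro X Y c u v (rfl | h | h)
      · exact ⟨le_rfl, le_rfl⟩
      · exact ⟨(c.lt_of_r h).le, (c.eq_of_r h).le⟩
      · exact ⟨(c.eq_of_s h).le, (c.lt_of_s h).le⟩
    have e := hle c h
    have e' := hle c h'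
    have f := hle F.compatible h
    have f' := hle F.compatible h'
    simp only [InBox, Set.uIcc_of_le, e.1, e.2, e'.1, e'.2, Set.mem_Icc] at hb hb'
    obtain ⟨⟨b1, b2⟩, b3, b4⟩ := hb
    obtain ⟨⟨b1', b2'⟩, b3', b4'⟩ := hb'
    have k1 := F.le_of_boxes_meet_aux c h h' (by linarith) (by linarith) (by linarith)
    have k2 := F.le_of_boxes_meet_aux c h' h (by linarith) (by linarith) (by linarith)
    have sw : ∀ {u v : V}, (u = v ∨ r u v ∨ s u v) → u = v ∨ s u v ∨ r u v := fun h =>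
      h.imp id Or.symm
    have k3 := F.swap.le_of_boxes_meet_aux c.swap (sw h) (sw h') (by linarith) (by linarith)
      (by linarith)
    have k4 := F.swap.le_of_boxes_meet_aux c.swap (sw h') (sw h) (by linarith) (by linarith)
      (by linarith)
    refine ⟨max (x u) (x u'), max (y u) (y u'), ?_, ?_⟩
    · simp only [InBox, Set.uIcc_of_le, f.1, f.2, Set.mem_Icc]
      exact ⟨⟨le_max_left _ _, max_le f.1 k1⟩, le_max_left _ _, max_le f.2 k3⟩
    · simp only [InBox, Set.uIcc_of_le, f'.1, f'.2, Set.mem_Icc]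
      exact ⟨⟨le_max_right _ _, max_le k2 f'.1⟩, le_max_right _ _, max_le k4 f'.2⟩
  have dir : ∀ {u v : V}, (u = v ∨ G.Adj u v) → (u = v ∨ r u v ∨ s u v) ∨
      (v = u ∨ r v u ∨ s v u) := by
    rintro u v (rfl | h)
    · exact Or.inl (Or.inl rfl)
    · rcases F.adj_cases h with (h | h) | (h | h) <;> simp [h]
  rcases dir h with h | h <;> rcases dir h' with h' | h'
  · exact key _ _ _ _ h h' hb hb'
  · obtain ⟨a, b, h1, h2⟩ := key _ _ _ _ h h' hb hb'.comm
    exact ⟨a, b, h1, h2.comm⟩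
  · obtain ⟨a, b, h1, h2⟩ := key _ _ _ _ h h' hb.comm hb'
    exact ⟨a, b, h1.comm, h2⟩
  · obtain ⟨a, b, h1, h2⟩ := key _ _ _ _ h h' hb.comm hb'.comm
    exact ⟨a, b, h1.comm, h2.comm⟩

end ConvexFrame

/-! ### Greedy drawings, locally -/

/-- For any two vertices `p ≠ q`, some neighbour of `p` is closer to `q` than `p`. -/
def LocallyGreedy (G : SimpleGraph V) (x y : V → ℝ) : Prop :=
  ∀ p q, p ≠ q → ∃ w, G.Adj p w ∧
    (x w - x q) ^ 2 + (y w - y q) ^ 2 < (x p - x q) ^ 2 + (y p - y q) ^ 2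

/-- If `q` lies in the vertical strip of the horizontal edge `p w`, and `p` has no vertical edge
towards the side of `q`, then `q` is closer to `w` than to `p` horizontally. -/
def Halfway (G : SimpleGraph V) (x y : V → ℝ) : Prop :=
  ∀ p w q, G.Adj p w → y p = y w → (x p ≤ x q ∧ x q < x w ∨ x w < x q ∧ x q ≤ x p) → y q ≠ y p →
    (∀ v, G.Adj p v → (y v - y p) * (y q - y p) ≤ 0) → (x w - x q) ^ 2 < (x p - x q) ^ 2

namespace Halfway

variable {G : SimpleGraph V} {x y : V → ℝ}

lemma negx (h : Halfway G x y) : Halfway G (fun v => -x v) y := by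
  intro p w q hadj hy hx hne hv
  have := h p w q hadj hy (hx.symm.imp (fun h => ⟨neg_le_neg_iff.1 h.2, neg_lt_neg_iff.1 h.1⟩)
    fun h => ⟨neg_lt_neg_iff.1 h.2, neg_le_neg_iff.1 h.1⟩) hne hv
  nlinarith

lemma negy (h : Halfway G x y) : Halfway G x (fun v => -y v) := by
  intro p w q hadj hy hx hne hv
  refine h p w q hadj (neg_injective hy) hx (fun h => hne (congrArg _ h)) fun v hpv => ?_
  have := hv v hpv
  nlinarith

end Halfway

namespace ConvexFrame

variable {G : SimpleGraph V} {x y : V → ℝ} {r s : V → V → Prop} {P : ℝ → ℝ → Prop}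

lemma sq_lt_sq_of_step {a b c : ℝ} (h1 : a < b) (h2 : b ≤ c) : (b - c) ^ 2 < (a - c) ^ 2 := by
  nlinarith

/-- A vertex `p` with an edge to the right and none upwards can step towards the vertices in its upper
right quadrant: this is where the halfway property is needed. -/
lemma exists_closer_of_right_only (F : ConvexFrame G x y r s P) (hx : Halfway G x y) {p q w : V}
    (hpq : p ≠ q) (h1 : x p ≤ x q) (h2 : y p ≤ y q) (hw : r p w) (hs : ∀ v, ¬ s p v) :
    ∃ w, G.Adj p w ∧ (x w - x q) ^ 2 + (y w - y q) ^ 2 < (x p - x q) ^ 2 + (y p - y q) ^ 2 := by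
  obtain ⟨hadj, hlt⟩ := (F.r_iff p w).1 hw
  refine ⟨w, hadj, ?_⟩
  rw [← F.y_eq_of_r hw]
  refine add_lt_add_left ?_ _
  rcases le_or_gt (x w) (x q) with h | h
  · exact sq_lt_sq_of_step hlt h
  have hy : y q ≠ y p := fun he => hpq (F.eq_left_of_mem hw he h1 h).symm
  refine hx p w q hadj (F.y_eq_of_r hw) (Or.inl ⟨h1, h⟩) hy fun v hpv => ?_
  have hv : y v ≤ y p := not_lt.1 fun hlt => hs v ((F.s_iff p v).2 ⟨hpv, hlt⟩)
  exact mul_nonpos_of_nonpos_of_nonneg (by linarith) (by linarith)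

variable [Finite V]

lemma exists_closer_of_le (F : ConvexFrame G x y r s P) (hx : Halfway G x y) (hy : Halfway G y x)
    {p q : V} (hpq : p ≠ q) (h1 : x p ≤ x q) (h2 : y p ≤ y q) :
    ∃ w, G.Adj p w ∧ (x w - x q) ^ 2 + (y w - y q) ^ 2 < (x p - x q) ^ 2 + (y p - y q) ^ 2 := by
  by_cases hr : ∃ v, r p v <;> by_cases hs : ∃ w, s p w
  · obtain ⟨v, hv⟩ := hr
    obtain ⟨w, hw⟩ := hs
    rcases F.not_mem_corner_box hv hw hpq.symm h1 h2 with h | h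
    · refine ⟨v, ((F.r_iff _ _).1 hv).1, ?_⟩
      rw [← F.y_eq_of_r hv]
      exact add_lt_add_left (sq_lt_sq_of_step ((F.r_iff _ _).1 hv).2 h) _
    · refine ⟨w, ((F.s_iff _ _).1 hw).1, ?_⟩
      rw [← F.x_eq_of_s hw]
      exact add_lt_add_right (sq_lt_sq_of_step ((F.s_iff _ _).1 hw).2 h) _
  · obtain ⟨v, hv⟩ := hr
    exact F.exists_closer_of_right_only hx hpq h1 h2 hv (not_exists.1 hs)
  · obtain ⟨w, hw⟩ := hs
    obtain ⟨w, h, h'⟩ := F.swap.exists_closer_of_right_only hy hpq h2 h1 hw (not_exists.1 hr)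
    exact ⟨w, h, by linarith⟩
  · exact absurd (F.eq_of_corner (not_exists.1 hr) (not_exists.1 hs) h1 h2) hpq.symm

theorem locallyGreedy (F : ConvexFrame G x y r s P) (hx : Halfway G x y) (hy : Halfway G y x) :
    LocallyGreedy G x y := by
  intro p q hpq
  rcases le_total (x p) (x q) with h1 | h1 <;> rcases le_total (y p) (y q) with h2 | h2
  · exact F.exists_closer_of_le hx hy hpq h1 h2
  · obtain ⟨w, h, h'⟩ := F.negy.exists_closer_of_le hx.negy hy.negx hpq h1 (neg_le_neg h2)
    exact ⟨w, h, by nlinarith⟩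
  · obtain ⟨w, h, h'⟩ := F.negx.exists_closer_of_le hx.negx hy.negy hpq (neg_le_neg h1) h2
    exact ⟨w, h, by nlinarith⟩
  · obtain ⟨w, h, h'⟩ := F.negx.negy.exists_closer_of_le hx.negx.negy hy.negy.negx hpq
      (neg_le_neg h1) (neg_le_neg h2)
    exact ⟨w, h, by nlinarith⟩

/-! ### From good orderings to greedy drawings -/

omit [Finite V] in
/-- The edge `p w` cuts the part of the drawing inside its vertical strip in two: if the position
of `q` is connected to that of `p` inside the strip, then `q` is not on a side of the line through
`p w` towards which `p` has no edge. -/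
lemma eq_of_connIn (F : ConvexFrame G x y r s P) {idx : V → ℕ} {E : ℕ → ℕ → Prop}
    (hidx : ∀ u v, idx u = idx v ↔ node s u = node s v)
    (hE : ∀ a b, E a b → ∃ u v, idx u = a ∧ idx v = b ∧ G.Adj u v)
    {I : Set ℕ} {p w q : V} (hadj : G.Adj p w) (hpw : y p = y w)
    (hI : ∀ v, idx v ∈ I → x v ∈ Set.uIcc (x p) (x w) ∧ x v ≠ x w) (hp : idx p ∈ I)
    (hside : ∀ v, G.Adj p v → (y v - y p) * (y q - y p) ≤ 0)
    (h : ConnIn E I (idx p) (idx q)) : y q = y p := by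
  -- The product is positive exactly for the vertices on the side of `q`. An edge that changes to
  -- that side is vertical and meets the line through `p w` on the edge `p w`, hence in `p`.
  have step : ∀ u v, G.Adj u v → idx u ∈ I → (y u - y p) * (y q - y p) ≤ 0 →
      (y v - y p) * (y q - y p) ≤ 0 := by
    intro u v huv hu hfu
    by_contra! hfv
    have hne : y u ≠ y v := fun he => by rw [he] at hfu; linarith
    have hxuv := (F.axis u v huv).resolve_right hne
    have hmem : y p ∈ Set.uIcc (y u) (y v) := by
      rw [Set.mem_uIcc]
      rcases pos_and_pos_or_neg_and_neg_of_mul_pos hfv with ⟨h1, h2⟩ | ⟨h1, h2⟩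
      · exact Or.inl ⟨by nlinarith, by linarith⟩
      · exact Or.inr ⟨by linarith, by nlinarith⟩
    obtain ⟨hu1, hu2⟩ := hI u hu
    rcases F.meet u v p w (Or.inr huv) (Or.inr hadj) (x u) (y p) ⟨Set.left_mem_uIcc, hmem⟩
      ⟨hu1, Set.left_mem_uIcc⟩ with he | ⟨z, hz, hz', hxz, hyz⟩
    · rcases Sym2.eq_iff.1 he with ⟨rfl, rfl⟩ | ⟨rfl, rfl⟩
      · exact hu2 hxuv
      · exact hu2 rfl
    · rcases hz' with rfl | rfl
      · rcases hz with rfl | rfl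
        · linarith [hside v huv]
        · simp at hfv
      · exact hu2 hxz.symm
  have onNode : ∀ u v, idx u = idx v → idx u ∈ I → (y u - y p) * (y q - y p) ≤ 0 →
      (y v - y p) * (y q - y p) ≤ 0 := by
    intro u v huv hu hfu
    refine node_induction (p := fun v => (y v - y p) * (y q - y p) ≤ 0) ((hidx u v).1 huv) hfu ?_
    intro a b ha hfa hab
    refine step a b ?_ (by rwa [(hidx a u).2 ha]) hfa
    exact hab.elim (fun h => ((F.s_iff _ _).1 h).1) fun h => ((F.s_iff _ _).1 h).1.symm
  have key := h.closed (p := fun a => ∀ v, idx v = a → (y v - y p) * (y q - y p) ≤ 0)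
    (fun v hv => onNode p v hv.symm hp (by simp)) ?_ q rfl
  · have : (y q - y p) ^ 2 = 0 := le_antisymm (by nlinarith) (sq_nonneg _)
    have := pow_eq_zero_iff (two_ne_zero) |>.1 this
    linarith
  · intro a ha b hb hfa hab v hv
    obtain ⟨u', v', rfl, rfl, huv⟩ := hE a b hab
    exact onNode v' v hv.symm hb (step u' v' huv ha (hfa u' rfl))

omit [Finite V] in
/-- Coordinates chosen for a good ordering of the nodes have the halfway property. -/
lemma halfway_of_coordinates (F : ConvexFrame G x y r s P) {idx : V → ℕ} {E : ℕ → ℕ → Prop}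
    {m : ℕ} (hm : ∀ v, idx v < m) (hidx : ∀ u v, idx u = idx v ↔ node s u = node s v)
    (hE : ∀ a b, E a b → ∃ u v, idx u = a ∧ idx v = b ∧ G.Adj u v) (hsymm : ∀ a b, E a b → E b a)
    {X : ℕ → ℝ} (hX : StrictMono X) (hx : ∀ v, x v = X (idx v))
    (hup : ∀ i j l, i < j → j < l → l < m → ¬ ConnIn E (Set.Ico i l) i j → X l - X j < X j - X i)
    (hdown : ∀ h i j, h < i → i < j → j < m → ¬ ConnIn E (Set.Ioc h j) i j →
      X i - X h < X j - X i) : Halfway G x y := by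
  intro p w q hadj hpw hq hne hside
  rcases hq with ⟨h1, h2⟩ | ⟨h1, h2⟩
  · rw [hx, hx, hX.le_iff_le] at h1
    rw [hx, hx, hX.lt_iff_lt] at h2
    have hnc : ¬ ConnIn E (Set.Ico (idx p) (idx w)) (idx p) (idx q) := fun h =>
      hne <| F.eq_of_connIn (I := Set.Ico (idx p) (idx w)) hidx hE hadj hpw (fun v hv => by
        rw [hx v, hx p, hx w]
        exact ⟨Set.mem_uIcc.2 (Or.inl ⟨hX.monotone hv.1, (hX hv.2).le⟩), (hX hv.2).ne⟩)
        ⟨le_rfl, h1.trans_lt h2⟩ hside h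
    have hlt : idx p < idx q := lt_of_le_of_ne h1 fun he => hnc (he ▸ .refl)
    have := hup _ _ _ hlt h2 (hm w) hnc
    have h3 := hX hlt
    have h4 := hX h2
    rw [hx, hx, hx]
    nlinarith
  · rw [hx, hx, hX.lt_iff_lt] at h1
    rw [hx, hx, hX.le_iff_le] at h2
    have hnc : ¬ ConnIn E (Set.Ioc (idx w) (idx p)) (idx q) (idx p) := fun h =>
      hne <| F.eq_of_connIn (I := Set.Ioc (idx w) (idx p)) hidx hE hadj hpw (fun v hv => by
        rw [hx v, hx p, hx w]
        exact ⟨Set.mem_uIcc.2 (Or.inr ⟨(hX hv.1).le, hX.monotone hv.2⟩), (hX hv.1).ne'⟩)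
        ⟨h1.trans_le h2, le_rfl⟩ hside (h.symm hsymm)
    have hlt : idx q < idx p := lt_of_le_of_ne h2 fun he => hnc (he ▸ .refl)
    have := hdown _ _ _ h1 hlt (hm p) hnc
    have h3 := hX hlt
    have h4 := hX h1
    rw [hx, hx, hx]
    nlinarith

/-! ### From greedy drawings to good orderings -/

/-- Incomparable nodes are separated by a horizontal line. -/
lemma separated_of_incomparable (F : ConvexFrame G x y r s P)
    {C C' : (SimpleGraph.fromRel s).ConnectedComponent} (hne : C ≠ C')
    (h : ¬ Relation.TransGen (contractedDigraph r s).Adj C C')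
    (h' : ¬ Relation.TransGen (contractedDigraph r s).Adj C' C) :
    (∀ u v, node s u = C → node s v = C' → y u < y v) ∨
      (∀ u v, node s u = C → node s v = C' → y v < y u) := by
  by_contra! hcon
  obtain ⟨⟨u, v, hu, hv, h1⟩, u', v', hu', hv', h2⟩ := hcon
  -- Two vertical intervals that are not separated meet, and nodes meeting a common horizontal line
  -- are comparable.
  have hmeet : ∃ a a' b, OnNode x y s C a b ∧ OnNode x y s C' a' b := by
    rcases le_total (y v) (y u') with h3 | h3
    · refine ⟨x u', x v, y u', hu' ▸ onNode_vertex u', ?_⟩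
      rw [← hv]
      exact F.onNode_of_between (hv.trans hv'.symm) h3 h2
    · refine ⟨x u', x v, y v, ?_, hv ▸ onNode_vertex v⟩
      rw [← hu']
      exact F.onNode_of_between (hu'.trans hu.symm) h3 h1
  obtain ⟨a, a', b, k1, k2⟩ := hmeet
  rcases le_total a a' with h3 | h3
  · rcases Relation.reflTransGen_iff_eq_or_transGen.1 (F.reach_of_onNode k1 k2 h3) with he | ht
    · exact hne he.symm
    · exact h ht
  · rcases Relation.reflTransGen_iff_eq_or_transGen.1 (F.reach_of_onNode k2 k1 h3) with he | ht
    · exact hne he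
    · exact h' ht

/-- A greedy step from the end of the node `C` that faces `v`; the function `f` covers the cases
that `C` lies below and above `v`. -/
lemma exists_closer_of_forall_lt (F : ConvexFrame G x y r s P) (hg : LocallyGreedy G x y)
    {C : (SimpleGraph.fromRel s).ConnectedComponent} {v : V} {f : V → ℝ}
    (hf : f = y ∨ f = fun v => -y v) (h : ∀ u, node s u = C → f u < f v) :
    ∃ u w, node s u = C ∧ G.Adj u w ∧ (x w - x v) ^ 2 < (x u - x v) ^ 2 := by
  have hne : {u | node s u = C}.Nonempty := C.exists_rep
  obtain ⟨u, hu, hmax⟩ := Set.exists_max_image _ f (Set.toFinite _) hne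
  obtain ⟨w, hadj, hw⟩ := hg u v (fun he => (h u hu).ne (congrArg f he))
  refine ⟨u, w, hu, hadj, ?_⟩
  rcases F.axis u w hadj with hx | hy
  -- A vertical edge stays on `C` and cannot lead closer, as `u` is the end of `C` facing `v`.
  · have h1 := hmax w ((F.node_eq_of_adj hadj hx).symm.trans hu)
    have h2 := h u hu
    rw [hx] at hw
    rcases hf with rfl | rfl <;> nlinarith
  · rw [hy] at hw
    linarith

/-- In a greedy drawing a node `C` that is incomparable to the node of `v` has a horizontal edge
that leads closer to `v` horizontally. -/
lemma exists_closer_of_incomparable (F : ConvexFrame G x y r s P) (hg : LocallyGreedy G x y)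
    {C : (SimpleGraph.fromRel s).ConnectedComponent} {v : V} (hne : C ≠ node s v)
    (h : ¬ Relation.TransGen (contractedDigraph r s).Adj C (node s v))
    (h' : ¬ Relation.TransGen (contractedDigraph r s).Adj (node s v) C) :
    ∃ u w, node s u = C ∧ G.Adj u w ∧ (x w - x v) ^ 2 < (x u - x v) ^ 2 := by
  rcases F.separated_of_incomparable hne h h' with hy | hy
  · exact F.exists_closer_of_forall_lt hg (Or.inl rfl) fun u hu => hy u v hu rfl
  · exact F.exists_closer_of_forall_lt hg (Or.inr rfl) fun u hu => neg_lt_neg (hy u v hu rfl)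

/-- The left-to-right order of the nodes in a greedy drawing is good. If `q` were separated from
both ends of an interval, let `a < q < c` be the nearest positions separated from `q`. No arc of
`a` or `c` ends strictly between `a` and `c`, so a greedy step from `a` towards `q` gets as far as `c`
and vice versa; hence `q` would lie beyond the midpoint of `a` and `c` in both directions. -/
theorem admitsGoodSTOrdering (F : ConvexFrame G x y r s P) (hg : LocallyGreedy G x y) :
    (contractedDigraph r s).AdmitsGoodSTOrdering := by
  set D := contractedDigraph r s with hD
  have : Finite (SimpleGraph.fromRel s).ConnectedComponent := Quot.finite _
  choose rep hrep using fun C : (SimpleGraph.fromRel s).ConnectedComponent => C.exists_rep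
  have hrep' : ∀ C, node s (rep C) = C := hrep
  have hx : ∀ v, x (rep (node s v)) = x v := fun v => F.x_eq_of_node (hrep' _)
  have hlt : ∀ {C C'}, Relation.TransGen D.Adj C C' → x (rep C) < x (rep C') := fun h =>
    F.compatible.lt_of_transGen h (hrep' _) (hrep' _)
  have hinj : Function.Injective fun C => x (rep C) := by
    intro C C' he
    by_contra hne
    have he : x (rep C) = x (rep C') := he
    obtain ⟨u, w, hu, -, hw⟩ := F.exists_closer_of_incomparable hg (v := rep C') (C := C)
      (by rwa [hrep']) (by rw [hrep']; exact fun h => (hlt h).ne he)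
      (by rw [hrep']; exact fun h => (hlt h).ne' he)
    rw [← hx u, hu, he] at hw
    nlinarith
  obtain ⟨m, σ, hσ⟩ := exists_sorting hinj
  have hst : D.IsSTOrdering σ := fun i j h => (hσ i j).2 (hlt (.single h))
  refine ⟨m, σ, hst, (D.isGoodOrdering_iff σ).2 fun i q j hiq hqj hj => ?_⟩
  by_contra! hcon
  set E := D.PosAdj σ
  have hE : ∀ u v, E u v → E v u := Digraph.PosAdj.symm
  classical
  obtain ⟨a, hia, haq, hna, hmax⟩ : ∃ a, i ≤ a ∧ a < q ∧ ¬ ConnIn E (Set.Icc i j) q a ∧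
      ∀ b, a < b → b < q → ConnIn E (Set.Icc i j) q b := by
    let p : ℕ → Prop := fun a => a < q ∧ ¬ ConnIn E (Set.Icc i j) q a
    have hs := Nat.findGreatest_spec (P := p) hiq.le ⟨hiq, hcon.1⟩
    refine ⟨Nat.findGreatest p q, Nat.le_findGreatest hiq.le ⟨hiq, hcon.1⟩, hs.1, hs.2, ?_⟩
    intro b h1 h2
    by_contra h3
    exact Nat.findGreatest_is_greatest h1 h2.le ⟨h2, h3⟩
  obtain ⟨c, hqc, hcj, hnc, hmin⟩ : ∃ c, q < c ∧ c ≤ j ∧ ¬ ConnIn E (Set.Icc i j) q c ∧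
      ∀ b, q < b → b < c → ConnIn E (Set.Icc i j) q b := by
    have hex : ∃ c, q < c ∧ ¬ ConnIn E (Set.Icc i j) q c := ⟨j, hqj, hcon.2⟩
    refine ⟨Nat.find hex, (Nat.find_spec hex).1, Nat.find_min' hex ⟨hqj, hcon.2⟩,
      (Nat.find_spec hex).2, fun b h1 h2 => ?_⟩
    by_contra h3
    exact Nat.find_min hex h2 ⟨h1, h3⟩
  have hconn : ∀ b, a < b → b < c → ConnIn E (Set.Icc i j) q b := by
    intro b h1 h2
    rcases lt_trichotomy b q with h | rfl | h
    · exact hmax b h1 h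
    · exact .refl
    · exact hmin b h h2
  have hend : ∀ b e, a < b → b < c → i ≤ e → e ≤ j → E e b → ConnIn E (Set.Icc i j) q e :=
    fun b e h1 h2 h3 h4 h => (hconn b h1 h2).tail ⟨⟨by omega, by omega⟩, ⟨h3, h4⟩, hE _ _ h⟩
  let a' : Fin m := ⟨a, by omega⟩
  let q' : Fin m := ⟨q, by omega⟩
  let c' : Fin m := ⟨c, by omega⟩
  have hpath : ∀ {k l : Fin m}, i ≤ k → (l : ℕ) ≤ j → Relation.TransGen D.Adj (σ k) (σ l) →
      ConnIn E (Set.Icc i j) k l := by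
    intro k l hk hl h
    have := (Digraph.connIn_of_transGen hst h).2
    simp only [Equiv.symm_apply_apply] at this
    exact this.mono (Set.Icc_subset_Icc hk hl)
  set v := rep (σ q') with hv
  have hnv : node s v = σ q' := hrep' _
  -- A greedy step towards `v` from a node separated from it changes the node.
  have hfar : ∀ e : Fin m, i ≤ e → (e : ℕ) ≤ j → ¬ ConnIn E (Set.Icc i j) q e →
      ∃ b : Fin m, E e b ∧ (x (rep (σ b)) - x v) ^ 2 < (x (rep (σ e)) - x v) ^ 2 := by
    intro e h1 h2 h3
    obtain ⟨u, w, hu, hadj, hw⟩ := F.exists_closer_of_incomparable hg (v := v) (C := σ e)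
      (by
        rw [hnv]
        intro he
        have := σ.injective he
        subst this
        exact h3 .refl)
      (by rw [hnv]; exact fun h => h3 ((hpath h1 hqj.le h).symm hE))
      (by rw [hnv]; exact fun h => h3 (hpath hiq.le h2 h))
    refine ⟨σ.symm (node s w), ?_, ?_⟩
    · have hxne : x u ≠ x w := fun he => by rw [he] at hw; exact lt_irrefl _ hw
      have hy := (F.axis u w hadj).resolve_left hxne
      rcases F.r_or_r hadj hy with h | h
      · have := Digraph.posAdj_of_adj σ (D := D) (show D.Adj (node s u) (node s w) from
          ⟨u, w, h, rfl, rfl⟩)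
        rwa [hu, Equiv.symm_apply_apply] at this
      · have := Digraph.posAdj_of_adj σ (D := D) (show D.Adj (node s w) (node s u) from
          ⟨w, u, h, rfl, rfl⟩)
        rw [hu, Equiv.symm_apply_apply] at this
        exact hE _ _ this
    · rwa [Equiv.apply_symm_apply, hx, ← hu, hx]
  have hmono : ∀ {k l : Fin m}, (k : ℕ) ≤ l → x (rep (σ k)) ≤ x (rep (σ l)) := by
    intro k l h
    by_contra! hlt
    exact absurd (Fin.lt_def.1 ((hσ l k).2 hlt)) (by omega)
  have haq' : x (rep (σ a')) < x v := (hσ a' q').1 haq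
  have hqc' : x v < x (rep (σ c')) := (hσ q' c').1 hqc
  have far_left : x (rep (σ c')) - x v < x v - x (rep (σ a')) := by
    obtain ⟨b, hb, hlt⟩ := hfar a' hia (show a ≤ j by omega) hna
    have hcb : (c' : ℕ) ≤ b := by
      by_contra! h1
      rcases lt_or_ge a b with h2 | h2
      · exact hna (hend b a h2 h1 hia (by omega) hb)
      · have := hmono (k := b) (l := a') h2
        nlinarith
    have := hmono hcb
    nlinarith
  have far_right : x v - x (rep (σ a')) < x (rep (σ c')) - x v := by
    obtain ⟨b, hb, hlt⟩ := hfar c' (show i ≤ c by omega) hcj hnc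
    have hba : (b : ℕ) ≤ a' := by
      by_contra! h1
      rcases lt_or_ge (b : ℕ) c with h2 | h2
      · exact hnc (hend b c h1 h2 (by omega) hcj hb)
      · have := hmono (k := c') (l := b) h2
        nlinarith
    have := hmono hba
    nlinarith
  linarith

end ConvexFrame

end Frame

/-! ### Drawings in coordinates -/

lemma mem_segment_iff_inBox {V : Type*} {pos : V → Plane} {u v : V}
    (h : pos u 0 = pos v 0 ∨ pos u 1 = pos v 1) (p : Plane) :
    p ∈ segment ℝ (pos u) (pos v) ↔
      InBox (fun v => pos v 0) (fun v => pos v 1) u v (p 0) (p 1) := by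
  unfold InBox
  rw [← segment_eq_uIcc, ← segment_eq_uIcc]
  constructor
  · rintro ⟨a, b, ha, hb, hab, rfl⟩
    exact ⟨⟨a, b, ha, hb, hab, by simp⟩, ⟨a, b, ha, hb, hab, by simp⟩⟩
  · rintro ⟨⟨a, b, ha, hb, hab, h0⟩, ⟨a', b', ha', hb', hab', h1⟩⟩
    simp only [smul_eq_mul] at h0 h1
    rcases h with h | h
    · refine ⟨a', b', ha', hb', hab', ?_⟩
      ext i
      fin_cases i
      · simp only [h, ← add_mul, hab, one_mul] at h0
        simp [h, ← add_mul, hab', h0]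
      · simpa using h1
    · refine ⟨a, b, ha, hb, hab, ?_⟩
      ext i
      fin_cases i
      · simpa using h0
      · simp only [h, ← add_mul, hab', one_mul] at h1
        simp [h, ← add_mul, hab, h1]

namespace RectilinearDrawing

variable {V : Type*} {G : SimpleGraph V}

lemma mem_support_iff (Γ : RectilinearDrawing G) (p : Plane) :
    p ∈ Γ.support ↔ Covered G (fun v => Γ.pos v 0) (fun v => Γ.pos v 1) (p 0) (p 1) := by
  constructor
  · rintro (⟨v, rfl⟩ | ⟨u, v, h, hp⟩)
    · exact covered_vertex (x := fun v => Γ.pos v 0) (y := fun v => Γ.pos v 1) v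
    · exact ⟨u, v, Or.inr h, (mem_segment_iff_inBox (Γ.axis_parallel u v h) p).1 hp⟩
  · rintro ⟨u, v, h, hp⟩
    rcases h with rfl | h
    · rw [← mem_segment_iff_inBox (Or.inl rfl), segment_same] at hp
      exact Or.inl ⟨u, hp.symm⟩
    · exact Or.inr ⟨u, v, h, (mem_segment_iff_inBox (Γ.axis_parallel u v h) p).2 hp⟩

/-- The boundary of a rectangular face belongs to the drawing: a boundary point off the drawing
could be added to the face. -/
lemma mem_support_of_mem_boundary (Γ : RectilinearDrawing G) {p : Plane} (hp : p ∉ Γ.support)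
    {a₁ a₂ b₁ b₂ : ℝ} (ha : a₁ < a₂) (hb : b₁ < b₂)
    (hface : Γ.face p = {q | q 0 ∈ Set.Ioo a₁ a₂ ∧ q 1 ∈ Set.Ioo b₁ b₂}) {a b : ℝ}
    (h1 : a ∈ Set.Icc a₁ a₂) (h2 : b ∈ Set.Icc b₁ b₂)
    (h : ¬ (a ∈ Set.Ioo a₁ a₂ ∧ b ∈ Set.Ioo b₁ b₂)) : !₂[a, b] ∈ Γ.support := by
  by_contra hw
  have hcl : !₂[a, b] ∈ closure (Γ.face p) := by
    have hcont : Continuous fun z : ℝ × ℝ => (!₂[z.1, z.2] : Plane) := by fun_prop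
    have himg : (fun z : ℝ × ℝ => (!₂[z.1, z.2] : Plane)) '' (Set.Ioo a₁ a₂ ×ˢ Set.Ioo b₁ b₂) ⊆
        Γ.face p := by
      rintro _ ⟨⟨z₁, z₂⟩, hz, rfl⟩
      rw [hface]
      simpa using hz
    refine closure_mono himg (image_closure_subset_closure_image hcont ⟨(a, b), ?_, rfl⟩)
    rw [closure_prod_eq, closure_Ioo ha.ne, closure_Ioo hb.ne]
    exact ⟨h1, h2⟩
  have hpre : IsPreconnected (insert !₂[a, b] (Γ.face p)) :=
    isPreconnected_connectedComponentIn.subset_closure (Set.subset_insert _ _)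
      (Set.insert_subset hcl subset_closure)
  have hsub : insert !₂[a, b] (Γ.face p) ⊆ Γ.face p := by
    refine hpre.subset_connectedComponentIn (Set.mem_insert_of_mem _ ?_) ?_
    · exact mem_connectedComponentIn hp
    · exact Set.insert_subset hw (connectedComponentIn_subset _ _)
  have := hsub (Set.mem_insert _ _)
  rw [hface] at this
  exact h (by simpa using this)

/-- A convex drawing of a connected graph, in coordinates. -/
lemma convexFrame (Γ : RectilinearDrawing G) (hG : G.Connected) {r s : V → V → Prop}
    (hr : ∀ u v, Γ.LeftOf u v ↔ r u v) (hs : ∀ u v, Γ.Below u v ↔ s u v)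
    (hint : Γ.InternalFacesRectangular) (hout : Γ.OuterFaceOrthoconvex) :
    ConvexFrame G (fun v => Γ.pos v 0) (fun v => Γ.pos v 1) r s
      (fun a b => !₂[a, b] ∈ Γ.outerPolygon) where
  conn := hG
  axis := Γ.axis_parallel
  inj u v h0 h1 := by
    refine Γ.injective ?_
    ext i
    fin_cases i
    · exact h0
    · exact h1
  r_iff u v := (hr u v).symm
  s_iff u v := (hs u v).symm
  meet u v u' v' h h' a b hb hb' := by
    have seg : ∀ {u v}, InBox (fun v => Γ.pos v 0) (fun v => Γ.pos v 1) u v a b →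
        (u = v ∨ G.Adj u v) → !₂[a, b] ∈ segment ℝ (Γ.pos u) (Γ.pos v) := by
      intro u v hb h
      refine (mem_segment_iff_inBox ?_ _).2 (by simpa using hb)
      rcases h with rfl | h
      · exact Or.inl rfl
      · exact Γ.axis_parallel u v h
    have coord : ∀ {w}, !₂[a, b] = Γ.pos w → Γ.pos w 0 = a ∧ Γ.pos w 1 = b := by
      intro w hw
      rw [← hw]
      simp
    have k := seg hb h
    have k' := seg hb' h'
    rcases h with rfl | h
    · rw [segment_same, Set.mem_singleton_iff] at k
      rw [k] at k'
      refine Or.inr ⟨u, Or.inl rfl, ?_, coord k⟩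
      rcases h' with rfl | h'
      · rw [segment_same, Set.mem_singleton_iff] at k'
        exact Or.inl (Γ.injective k')
      · exact Γ.vertex_on_edge _ _ _ h' k'
    · rcases h' with rfl | h'
      · rw [segment_same, Set.mem_singleton_iff] at k'
        rw [k'] at k
        exact Or.inr ⟨u', Γ.vertex_on_edge _ _ _ h k, Or.inl rfl, coord k'⟩
      · by_cases he : s(u, v) = s(u', v')
        · exact Or.inl he
        · obtain ⟨w, h1, h2, h3⟩ := Γ.planar u v u' v' h h' he _ ⟨k, k'⟩
          exact Or.inr ⟨w, Sym2.mem_iff.1 h1, Sym2.mem_iff.1 h2, coord h3⟩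
  sub a b h := Or.inl ((Γ.mem_support_iff _).2 (by simpa using h))
  conv_h a a' a'' b h h' h1 h2 := (hout.1 b).out h h' ⟨h1, h2⟩
  conv_v a b b' b'' h h' h1 h2 := (hout.2 a).out h h' ⟨h1, h2⟩
  face a b h hc := by
    have cov : ∀ a b, !₂[a, b] ∈ Γ.support ↔
        Covered G (fun v => Γ.pos v 0) (fun v => Γ.pos v 1) a b := fun a b => by
      rw [Γ.mem_support_iff]
      simp
    rw [← cov] at hc
    have hmem : !₂[a, b] ∈ Γ.face !₂[a, b] := mem_connectedComponentIn hc
    obtain ⟨a₁, a₂, b₁, b₂, hface⟩ := hint _ hc (h.resolve_left hc)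
    have hmem' := hmem
    rw [hface] at hmem'
    obtain ⟨⟨h1, h2⟩, h3, h4⟩ : (a₁ < a ∧ a < a₂) ∧ b₁ < b ∧ b < b₂ := by simpa using hmem'
    have hbd : ∀ {a' b'}, a' ∈ Set.Icc a₁ a₂ → b' ∈ Set.Icc b₁ b₂ →
        ¬ (a' ∈ Set.Ioo a₁ a₂ ∧ b' ∈ Set.Ioo b₁ b₂) →
        Covered G (fun v => Γ.pos v 0) (fun v => Γ.pos v 1) a' b' := fun k1 k2 k3 =>
      (cov _ _).1 (Γ.mem_support_of_mem_boundary hc (h1.trans h2) (h3.trans h4) hface k1 k2 k3)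
    have hle := (h1.trans h2).le
    have hle' := (h3.trans h4).le
    refine ⟨a₁, a₂, b₁, b₂, h1, h2, h3, h4, fun a' b' k1 k2 k3 k4 hcov => ?_,
      fun a' k1 k2 => ⟨hbd ⟨k1, k2⟩ ⟨le_rfl, hle'⟩ (by simp), hbd ⟨k1, k2⟩ ⟨hle', le_rfl⟩ (by simp)⟩,
      fun b' k1 k2 => ⟨hbd ⟨le_rfl, hle⟩ ⟨k1, k2⟩ (by simp), hbd ⟨hle, le_rfl⟩ ⟨k1, k2⟩ (by simp)⟩⟩
    have : !₂[a', b'] ∈ Γ.face !₂[a, b] := by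
      rw [hface]
      simp [k1, k2, k3, k4]
    exact connectedComponentIn_subset _ _ this ((cov _ _).2 hcov)

lemma dist_lt_dist_iff (p q o : Plane) : dist p o < dist q o ↔
    (p 0 - o 0) ^ 2 + (p 1 - o 1) ^ 2 < (q 0 - o 0) ^ 2 + (q 1 - o 1) ^ 2 := by
  rw [EuclideanSpace.dist_eq, EuclideanSpace.dist_eq, Real.sqrt_lt_sqrt_iff (by positivity)]
  simp [Fin.sum_univ_two, Real.dist_eq, sq_abs]

/-- Greedy drawings are characterized by single steps. -/
lemma isGreedy_iff [Finite V] (Γ : RectilinearDrawing G) :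
    Γ.IsGreedy ↔ LocallyGreedy G (fun v => Γ.pos v 0) (fun v => Γ.pos v 1) := by
  constructor
  · intro h p q hpq
    obtain ⟨w, -, hw⟩ := h p q
    cases w with
    | nil => exact absurd rfl hpq
    | @cons _ v _ hadj w =>
      have := hw 0 (by simp)
      rw [dist_lt_dist_iff] at this
      exact ⟨v, hadj, by simpa using this⟩
  · intro h u v
    suffices ∃ p : G.Walk u v, p.IsPath ∧ Γ.DistanceDecreasing p ∧
        ∀ w ∈ p.support, dist (Γ.pos w) (Γ.pos v) ≤ dist (Γ.pos u) (Γ.pos v) from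
      let ⟨p, h1, h2, _⟩ := this
      ⟨p, h1, h2⟩
    induction hn : {w | dist (Γ.pos w) (Γ.pos v) < dist (Γ.pos u) (Γ.pos v)}.ncard using
      Nat.strong_induction_on generalizing u with
    | _ n ih =>
      by_cases huv : u = v
      · subst huv
        exact ⟨.nil, by simp, fun i hi => by simp at hi, by simp⟩
      obtain ⟨w, hadj, hw⟩ := h u v huv
      rw [← dist_lt_dist_iff] at hw
      obtain ⟨p, h1, h2, h3⟩ := ih _ (by
        rw [← hn]
        refine Set.ncard_lt_ncard ⟨fun z hz => lt_trans hz hw, fun hsub => ?_⟩ (Set.toFinite _)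
        have : dist (Γ.pos w) (Γ.pos v) < dist (Γ.pos w) (Γ.pos v) := hsub hw
        exact lt_irrefl _ this) w rfl
      refine ⟨.cons hadj p, ?_, ?_, ?_⟩
      · rw [SimpleGraph.Walk.cons_isPath_iff]
        exact ⟨h1, fun hu => absurd (h3 u hu) (not_le.2 hw)⟩
      · rintro (_ | i) hi
        · simpa using hw
        · simpa using h2 i (by simpa using hi)
      · intro z hz
        rw [SimpleGraph.Walk.support_cons, List.mem_cons] at hz
        rcases hz with rfl | hz
        · exact le_rfl
        · exact (h3 z hz).trans hw.le

end RectilinearDrawing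

/-! ### Drawings with prescribed coordinates -/

namespace ConvexFrame

variable {V : Type*} {G : SimpleGraph V} {x y : V → ℝ} {r s : V → V → Prop} {P : ℝ → ℝ → Prop}

lemma right_unique (F : ConvexFrame G x y r s P) {w u v : V} (hu : r w u) (hv : r w v) : u = v := by
  have key : ∀ {u v}, r w u → r w v → ¬ x u < x v := fun {u v} hu hv h =>
    ((F.r_iff w u).1 hu).1.ne (F.eq_left_of_mem hv (F.y_eq_of_r hu).symm
      ((F.r_iff w u).1 hu).2.le h).symm
  exact F.inj u v (le_antisymm (not_lt.1 (key hv hu)) (not_lt.1 (key hu hv)))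
    ((F.y_eq_of_r hu).symm.trans (F.y_eq_of_r hv))

/-- Two edges at a common vertex `w` meet only there, in every drawing with the same directions. -/
lemma eq_of_inBox (F : ConvexFrame G x y r s P) {X Y : V → ℝ} (c : Compatible r s X Y) {w u v : V}
    (hu : G.Adj w u) (hv : G.Adj w v) (hne : u ≠ v) {a b : ℝ} (h : InBox X Y w u a b)
    (h' : InBox X Y w v a b) : a = X w ∧ b = Y w := by
  have key : ∀ {u}, G.Adj w u → InBox X Y w u a b →
      (r w u ∧ X w ≤ a ∧ b = Y w) ∨ (r u w ∧ a ≤ X w ∧ b = Y w) ∨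
      (s w u ∧ a = X w ∧ Y w ≤ b) ∨ (s u w ∧ a = X w ∧ b ≤ Y w) := by
    rintro u hu ⟨h1, h2⟩
    rcases F.adj_cases hu with (h | h) | (h | h)
    · rw [← c.eq_of_r h, Set.uIcc_self] at h2
      rw [Set.uIcc_of_le (c.lt_of_r h).le] at h1
      exact Or.inl ⟨h, h1.1, h2⟩
    · rw [c.eq_of_r h, Set.uIcc_self] at h2
      rw [Set.uIcc_of_ge (c.lt_of_r h).le] at h1
      exact Or.inr (Or.inl ⟨h, h1.2, h2⟩)
    · rw [← c.eq_of_s h, Set.uIcc_self] at h1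
      rw [Set.uIcc_of_le (c.lt_of_s h).le] at h2
      exact Or.inr (Or.inr (Or.inl ⟨h, h1, h2.1⟩))
    · rw [c.eq_of_s h, Set.uIcc_self] at h1
      rw [Set.uIcc_of_ge (c.lt_of_s h).le] at h2
      exact Or.inr (Or.inr (Or.inr ⟨h, h1, h2.2⟩))
  rcases key hu h with ⟨k, k1, k2⟩ | ⟨k, k1, k2⟩ | ⟨k, k1, k2⟩ | ⟨k, k1, k2⟩ <;>
    rcases key hv h' with ⟨l, l1, l2⟩ | ⟨l, l1, l2⟩ | ⟨l, l1, l2⟩ | ⟨l, l1, l2⟩ <;>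
    first
      | exact ⟨by linarith, by linarith⟩
      | exact absurd (F.right_unique k l) hne
      | exact absurd (F.negx.right_unique k l) hne
      | exact absurd (F.swap.right_unique k l) hne
      | exact absurd (F.swap.negx.right_unique k l) hne

lemma eq_or_eq_of_adj (F : ConvexFrame G x y r s P) {X Y : V → ℝ} (c : Compatible r s X Y) {u v : V}
    (h : G.Adj u v) : X u = X v ∨ Y u = Y v := by
  rcases F.adj_cases h with (h | h) | (h | h)
  · exact Or.inr (c.eq_of_r h)
  · exact Or.inr (c.eq_of_r h).symm
  · exact Or.inl (c.eq_of_s h)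
  · exact Or.inl (c.eq_of_s h).symm

/-- Compatible coordinates define a planar drawing. -/
def toDrawing [Finite V] (F : ConvexFrame G x y r s P) {X Y : V → ℝ} (c : Compatible r s X Y) :
    RectilinearDrawing G where
  pos v := !₂[X v, Y v]
  injective u v h := by
    have hX : X u = X v := by simpa using congrFun (congrArg WithLp.ofLp h) 0
    have hY : Y u = Y v := by simpa using congrFun (congrArg WithLp.ofLp h) 1
    obtain ⟨a, b, h1, h2⟩ := F.inBox_of_inBox c (u := u) (v := u) (u' := v) (v' := v) (Or.inl rfl)
      (Or.inl rfl) (a := X u) (b := Y u) (by simp [InBox]) (by simp [InBox, hX, hY])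
    simp only [InBox, Set.uIcc_self, Set.mem_singleton_iff] at h1 h2
    exact F.inj u v (h1.1.symm.trans h2.1) (h1.2.symm.trans h2.2)
  axis_parallel u v h := by simpa using F.eq_or_eq_of_adj c h
  vertex_on_edge u v w h hw := by
    have hb := (mem_segment_iff_inBox (pos := fun v => !₂[X v, Y v])
      (by simpa using F.eq_or_eq_of_adj c h) _).1 hw
    obtain ⟨a, b, h1, h2⟩ := F.inBox_of_inBox c (u := u) (v := v) (u' := w) (v' := w) (Or.inr h)
      (Or.inl rfl) (a := X w) (b := Y w) (by simpa using hb) (by simp [InBox])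
    rcases F.meet u v w w (Or.inr h) (Or.inl rfl) a b h1 h2 with he | ⟨z, hz, hz', -⟩
    · rcases Sym2.eq_iff.1 he with ⟨h1, -⟩ | ⟨h1, -⟩ <;> exact Or.inl h1.symm
    · rcases hz' with rfl | rfl <;> exact hz
  planar u v u' v' h h' hne p hp := by
    have hb : InBox X Y u v (p 0) (p 1) := by
      simpa using (mem_segment_iff_inBox (pos := fun v => !₂[X v, Y v])
        (by simpa using F.eq_or_eq_of_adj c h) _).1 hp.1
    have hb' : InBox X Y u' v' (p 0) (p 1) := by
      simpa using (mem_segment_iff_inBox (pos := fun v => !₂[X v, Y v])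
        (by simpa using F.eq_or_eq_of_adj c h') _).1 hp.2
    obtain ⟨a, b, h1, h2⟩ := F.inBox_of_inBox c (Or.inr h) (Or.inr h') hb hb'
    obtain ⟨w, hw, hw', -⟩ := (F.meet u v u' v' (Or.inr h) (Or.inr h') a b h1 h2).resolve_left hne
    refine ⟨w, Sym2.mem_iff.2 hw, Sym2.mem_iff.2 hw', ?_⟩
    suffices p 0 = X w ∧ p 1 = Y w by
      ext i
      fin_cases i
      · simpa using this.1
      · simpa using this.2
    rcases hw with rfl | rfl <;> rcases hw' with rfl | rfl
    · exact F.eq_of_inBox c h h' (by rintro rfl; exact hne rfl) hb hb'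
    · exact F.eq_of_inBox c h h'.symm (by rintro rfl; exact hne Sym2.eq_swap) hb hb'.comm
    · exact F.eq_of_inBox c h.symm h' (by rintro rfl; exact hne Sym2.eq_swap) hb.comm hb'
    · exact F.eq_of_inBox c h.symm h'.symm (by rintro rfl; exact hne rfl) hb.comm hb'.comm

lemma leftOf_toDrawing_iff [Finite V] (F : ConvexFrame G x y r s P) {X Y : V → ℝ}
    (c : Compatible r s X Y) (u v : V) : (F.toDrawing c).LeftOf u v ↔ r u v := by
  have : (F.toDrawing c).LeftOf u v ↔ G.Adj u v ∧ X u < X v := by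
    simp [RectilinearDrawing.LeftOf, toDrawing]
  rw [this]
  refine ⟨fun ⟨h, hlt⟩ => ?_, fun h => ⟨((F.r_iff u v).1 h).1, c.lt_of_r h⟩⟩
  rcases F.adj_cases h with (h | h) | (h | h)
  · exact h
  · exact absurd (c.lt_of_r h) hlt.not_gt
  · exact absurd (c.eq_of_s h) hlt.ne
  · exact absurd (c.eq_of_s h) hlt.ne'

lemma below_toDrawing_iff [Finite V] (F : ConvexFrame G x y r s P) {X Y : V → ℝ}
    (c : Compatible r s X Y) (u v : V) : (F.toDrawing c).Below u v ↔ s u v := by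
  have : (F.toDrawing c).Below u v ↔ (F.swap.toDrawing c.swap).LeftOf u v := by
    simp [RectilinearDrawing.LeftOf, RectilinearDrawing.Below, toDrawing]
  rw [this, leftOf_toDrawing_iff]

/-- The position, in an ordering of the nodes, of the node of a vertex. -/
def position {m : ℕ} (σ : Fin m ≃ (SimpleGraph.fromRel s).ConnectedComponent) (v : V) : ℕ :=
  σ.symm (node s v)

lemma position_eq_iff {m : ℕ} (σ : Fin m ≃ (SimpleGraph.fromRel s).ConnectedComponent) (u v : V) :
    position σ u = position σ v ↔ node s u = node s v := by
  rw [position, position, ← Fin.ext_iff, σ.symm.injective.eq_iff]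

/-- A good ordering of the nodes yields coordinates that respect the directions of the edges and
have the halfway property in every convex drawing that uses them. -/
lemma exists_halfway_coordinates (F : ConvexFrame G x y r s P)
    (h : (contractedDigraph r s).AdmitsGoodSTOrdering) :
    ∃ X : V → ℝ, (∀ u v, r u v → X u < X v) ∧ (∀ u v, s u v → X u = X v) ∧
      ∀ (Y : V → ℝ) (Q : ℝ → ℝ → Prop), ConvexFrame G X Y r s Q → Halfway G X Y := by
  obtain ⟨m, σ, hst, hgood⟩ := h
  rw [Digraph.isGoodOrdering_iff] at hgood
  obtain ⟨X, hX, hup, hdown⟩ := exists_coordinates Digraph.PosAdj.symm hgood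
  refine ⟨fun v => X (position σ v), fun u v h => hX ?_, fun u v h => ?_, fun Y Q F' => ?_⟩
  · exact Fin.lt_def.1 (hst _ _ (by
      rw [Equiv.apply_symm_apply, Equiv.apply_symm_apply]
      exact ⟨u, v, h, rfl, rfl⟩))
  · exact congrArg X ((position_eq_iff σ u v).2 (F.node_eq_of_s h))
  · refine F'.halfway_of_coordinates (fun v => Fin.is_lt _) (position_eq_iff σ) ?_
      Digraph.PosAdj.symm hX (fun _ => rfl) hup hdown
    have hpos : ∀ {k v}, node s v = σ k → position σ v = k := fun h => by
      rw [position, h, Equiv.symm_apply_apply]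
    rintro a b ⟨ha, hb, ⟨u, v, h, hu, hv⟩ | ⟨u, v, h, hu, hv⟩⟩
    · exact ⟨u, v, hpos hu, hpos hv, ((F.r_iff _ _).1 h).1⟩
    · exact ⟨v, u, hpos hv, hpos hu, ((F.r_iff _ _).1 h).1.symm⟩

end ConvexFrame

/-! ### The characterization of greedy realizability -/

theorem mainTheorem1 {V : Type*} [Finite V] (G : SimpleGraph V) (hG : G.IsBiconnected)
    (H : RectilinearRepresentation G) (hH : H.IsConvex) :
    H.GreedyRealizable ↔ H.Dx.AdmitsGoodSTOrdering ∧ H.Dy.AdmitsGoodSTOrdering := by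
  have frame : ∀ Γ : RectilinearDrawing G, H.IsDrawing Γ →
      ConvexFrame G (fun v => Γ.pos v 0) (fun v => Γ.pos v 1) H.leftOf H.below
        (fun a b => !₂[a, b] ∈ Γ.outerPolygon) := fun Γ hΓ =>
    Γ.convexFrame hG.1 hΓ.1 hΓ.2 (hH Γ hΓ).1 (hH Γ hΓ).2
  constructor
  · rintro ⟨Γ, hΓ, hgreedy⟩
    rw [Γ.isGreedy_iff] at hgreedy
    refine ⟨(frame Γ hΓ).admitsGoodSTOrdering hgreedy,
      (frame Γ hΓ).swap.admitsGoodSTOrdering fun p q hpq => ?_⟩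
    obtain ⟨w, hw, hlt⟩ := hgreedy p q hpq
    exact ⟨w, hw, by linarith⟩
  · rintro ⟨hx, hy⟩
    obtain ⟨Γ, hΓ⟩ := H.realized
    have F := frame Γ hΓ
    obtain ⟨X, hXr, hXs, hX⟩ := F.exists_halfway_coordinates hx
    obtain ⟨Y, hYs, hYr, hY⟩ := F.swap.exists_halfway_coordinates hy
    have c : Compatible H.leftOf H.below X Y :=
      ⟨hXr _ _, hXs _ _, hYs _ _, hYr _ _⟩
    have hΓ' : H.IsDrawing (F.toDrawing c) :=
      ⟨F.leftOf_toDrawing_iff c, F.below_toDrawing_iff c⟩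
    -- Convexity is a property of every drawing of `H`, so it passes to the new one.
    have F' := frame _ hΓ'
    refine ⟨F.toDrawing c, hΓ', (F.toDrawing c).isGreedy_iff.2 ?_⟩
    have hpos : (fun v => (F.toDrawing c).pos v 0) = X ∧ (fun v => (F.toDrawing c).pos v 1) = Y :=
      ⟨by ext; simp [ConvexFrame.toDrawing], by ext; simp [ConvexFrame.toDrawing]⟩
    rw [hpos.1, hpos.2] at F' ⊢
    exact F'.locallyGreedy (hX _ _ F') (hY _ _ F'.swap)
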